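/- Let $k$ be an algebraically closed field, let $r \geq 3$ and $1 < d < r$ be integers, and let $K_r$ be the Kronecker quiver with two vertices $1, 2$ and $r$ arrows $\gamma_1, \dots, \gamma_r \colon 1 \to 2$, with arrow space $A_r = \bigoplus_{i=1}^r k\gamma_i$. A representation $M \in \mathrm{rep}(K_r)$ is a triple $(M_1, M_2, \psi_M)$ of finite-dimensional $k$-vector spaces $M_1, M_2$ and a $k$-linear map $\psi_M \colon A_r \otimes_k M_1 \to M_2$; its dimension vector is $\underline{\dim}\, M = (\dim_k M_1, \dim_k M_2)$. For $1 \leq e \leq r$ and an injective linear map $\alpha \colon A_e \to A_r$, let $\alpha^*(M) = (M_1, M_2, \psi_M \circ (\alpha \otimes \mathrm{id}_{M_1})) \in \mathrm{rep}(K_e)$. The $e$-th rank variety $\mathcal{V}(K_r, e)_M$ is the set of all $\mathfrak{v}$ in the Grassmannian $\mathrm{Gr}_e(A_r)$ of $e$-dimensional subspaces of $A_r$ such that $\alpha^*(M)$ is not projective for all injective $\alpha \colon A_e \to A_r$ with image $\mathfrak{v}$. The representation $M$ is relative $e$-projective if $\mathcal{V}(K_r, e)_M = \emptyset$. It is a brick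 if $M \neq 0$ and $\mathrm{End}_{K_r}(M) = k \cdot \mathrm{id}_M$, and it is regular if no indecomposable direct summand of $M$ lies in the connected component of the Auslander–Reiten quiver of $K_r$ that contains the simple representation with dimension vector $(0,1)$ (the preprojective component) or in the one that contains the simple representation with dimension vector $(1,0)$ (the preinjective component). Theorem 6.5.6. For every non-empty finite set $X \subseteq \mathrm{Gr}_d(A_r)$ there exists a regular brick $E_X \in \mathrm{rep}(K_r)$ such that 1. $\mathcal{V}(K_r, d)_{E_X} = X$, 2. $\mathcal{V}(K_r, d-1)_{E_X} = \emptyset$, that is, $E_X$ is relative $(d-1)$-projective, and 3. $\underline{\dim}\, E_X = \bigl(|X| \cdot (d(r-d) - 1) + 1\bigr) \cdot (d, rd - 1)$. -/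

import Mathlib

open CategoryTheory CategoryTheory.Limits
open scoped TensorProduct

universe u

/-- The arrow space `A_r` of the Kronecker quiver `K_r`, with basis the `r` arrows. -/
abbrev ArrowSpace (k : Type u) (r : ℕ) : Type u := Fin r → k

/-- A finite-dimensional representation of the Kronecker quiver `K_r` over `k`: vector spaces
`V1`, `V2` and a structure map `ψ : A_r ⊗ V1 → V2`. -/
structure KRep (k : Type u) [Field k] (r : ℕ) where
  V1 : Type u
  V2 : Type u
  [acg1 : AddCommGroup V1]
  [acg2 : AddCommGroup V2]
  [mod1 : Module k V1]
  [mod2 : Module k V2]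
  [fin1 : FiniteDimensional k V1]
  [fin2 : FiniteDimensional k V2]
  ψ : ArrowSpace k r ⊗[k] V1 →ₗ[k] V2

namespace KRep

attribute [instance] acg1 acg2 mod1 mod2 fin1 fin2

variable {k : Type u} [Field k] {r : ℕ}

/-- Morphisms of representations of `K_r`. -/
@[ext]
structure Hom (M N : KRep k r) where
  f1 : M.V1 →ₗ[k] N.V1
  f2 : M.V2 →ₗ[k] N.V2
  comm : f2 ∘ₗ M.ψ = N.ψ ∘ₗ f1.lTensor (ArrowSpace k r)

/-- The category `rep(K_r)`. -/
instance category : Category (KRep k r) where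
  Hom M N := Hom M N
  id M := ⟨LinearMap.id, LinearMap.id, by simp⟩
  comp f g := ⟨g.f1 ∘ₗ f.f1, g.f2 ∘ₗ f.f2, by
    rw [LinearMap.comp_assoc, f.comm, ← LinearMap.comp_assoc, g.comm, LinearMap.comp_assoc,
      LinearMap.lTensor_comp]⟩

@[ext]
theorem hom_ext {M N : KRep k r} {f g : M ⟶ N} (h1 : f.f1 = g.f1) (h2 : f.f2 = g.f2) : f = g :=
  Hom.ext h1 h2

@[simp]
theorem id_f1 (M : KRep k r) : (𝟙 M : M ⟶ M).f1 = LinearMap.id := rfl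

@[simp]
theorem id_f2 (M : KRep k r) : (𝟙 M : M ⟶ M).f2 = LinearMap.id := rfl

@[simp]
theorem comp_f1 {M N L : KRep k r} (f : M ⟶ N) (g : N ⟶ L) : (f ≫ g).f1 = g.f1 ∘ₗ f.f1 := rfl

@[simp]
theorem comp_f2 {M N L : KRep k r} (f : M ⟶ N) (g : N ⟶ L) : (f ≫ g).f2 = g.f2 ∘ₗ f.f2 := rfl

section Additive

variable (M N : KRep k r)

instance : Zero (M ⟶ N) := ⟨⟨0, 0, by simp⟩⟩

instance : Add (M ⟶ N) := ⟨fun f g => ⟨f.f1 + g.f1, f.f2 + g.f2, by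
  rw [LinearMap.add_comp, f.comm, g.comm, LinearMap.lTensor_add, LinearMap.comp_add]⟩⟩

instance : Neg (M ⟶ N) := ⟨fun f => ⟨-f.f1, -f.f2, by
  rw [LinearMap.neg_comp, f.comm, LinearMap.lTensor_neg, LinearMap.comp_neg]⟩⟩

@[simp]
theorem zero_f1 : (0 : M ⟶ N).f1 = 0 := rfl

@[simp]
theorem zero_f2 : (0 : M ⟶ N).f2 = 0 := rfl

@[simp]
theorem add_f1 (f g : M ⟶ N) : (f + g).f1 = f.f1 + g.f1 := rfl

@[simp]
theorem add_f2 (f g : M ⟶ N) : (f + g).f2 = f.f2 + g.f2 := rfl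

@[simp]
theorem neg_f1 (f : M ⟶ N) : (-f).f1 = -f.f1 := rfl

@[simp]
theorem neg_f2 (f : M ⟶ N) : (-f).f2 = -f.f2 := rfl

instance : AddCommGroup (M ⟶ N) where
  add_assoc f g h := hom_ext (add_assoc _ _ _) (add_assoc _ _ _)
  zero_add f := hom_ext (zero_add _) (zero_add _)
  add_zero f := hom_ext (add_zero _) (add_zero _)
  add_comm f g := hom_ext (add_comm _ _) (add_comm _ _)
  neg_add_cancel f := hom_ext (neg_add_cancel _) (neg_add_cancel _)
  nsmul := nsmulRec
  zsmul := zsmulRec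

end Additive

instance preadditive : Preadditive (KRep k r) where
  add_comp _ _ _ f f' g := hom_ext (LinearMap.comp_add _ _ _) (LinearMap.comp_add _ _ _)
  comp_add _ _ _ f g g' := hom_ext (LinearMap.add_comp _ _ _) (LinearMap.add_comp _ _ _)

/-- The direct sum of two representations. -/
def prod (M N : KRep k r) : KRep k r where
  V1 := M.V1 × N.V1
  V2 := M.V2 × N.V2
  ψ := (M.ψ ∘ₗ (LinearMap.fst k M.V1 N.V1).lTensor (ArrowSpace k r)).prod
    (N.ψ ∘ₗ (LinearMap.snd k M.V1 N.V1).lTensor (ArrowSpace k r))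

section

variable {A U V U' V' : Type*} [AddCommGroup A] [AddCommGroup U] [AddCommGroup V]
  [AddCommGroup U'] [AddCommGroup V'] [Module k A] [Module k U] [Module k V] [Module k U']
  [Module k V'] (p : A ⊗[k] U →ₗ[k] V) (q : A ⊗[k] U' →ₗ[k] V')

theorem inl_comm : LinearMap.inl k V V' ∘ₗ p =
    ((p ∘ₗ (LinearMap.fst k U U').lTensor A).prod (q ∘ₗ (LinearMap.snd k U U').lTensor A)) ∘ₗ
      (LinearMap.inl k U U').lTensor A :=
  TensorProduct.ext' fun _ _ => by simp

theorem inr_comm : LinearMap.inr k V V' ∘ₗ q =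
    ((p ∘ₗ (LinearMap.fst k U U').lTensor A).prod (q ∘ₗ (LinearMap.snd k U U').lTensor A)) ∘ₗ
      (LinearMap.inr k U U').lTensor A :=
  TensorProduct.ext' fun _ _ => by simp

end

/-- The inclusions and projections of the direct sum. -/
def bicone (M N : KRep k r) : BinaryBicone M N where
  pt := M.prod N
  fst := ⟨LinearMap.fst k _ _, LinearMap.fst k _ _, LinearMap.fst_prod _ _⟩
  snd := ⟨LinearMap.snd k _ _, LinearMap.snd k _ _, LinearMap.snd_prod _ _⟩
  inl := ⟨LinearMap.inl k _ _, LinearMap.inl k _ _, inl_comm M.ψ N.ψ⟩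
  inr := ⟨LinearMap.inr k _ _, LinearMap.inr k _ _, inr_comm M.ψ N.ψ⟩
  inl_fst := hom_ext (LinearMap.ext fun _ => rfl) (LinearMap.ext fun _ => rfl)
  inl_snd := hom_ext (LinearMap.ext fun _ => rfl) (LinearMap.ext fun _ => rfl)
  inr_fst := hom_ext (LinearMap.ext fun _ => rfl) (LinearMap.ext fun _ => rfl)
  inr_snd := hom_ext (LinearMap.ext fun _ => rfl) (LinearMap.ext fun _ => rfl)

instance hasBinaryBiproducts : HasBinaryBiproducts (KRep k r) where
  has_binary_biproduct M N := HasBinaryBiproduct.mk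
    ⟨bicone M N, isBinaryBilimitOfTotal _ (hom_ext
      (LinearMap.ext fun x => Prod.ext (add_zero x.1) (zero_add x.2))
      (LinearMap.ext fun x => Prod.ext (add_zero x.1) (zero_add x.2)))⟩

/-- The dimension vector of `M`. -/
noncomputable def dimVector (M : KRep k r) : ℕ × ℕ :=
  (Module.finrank k M.V1, Module.finrank k M.V2)

/-- `M` is a brick: it is non-zero and `End(M) = k · id`. -/
def IsBrick (M : KRep k r) : Prop :=
  ¬ IsZero M ∧ ∀ f : M ⟶ M, ∃ c : k, f.f1 = c • LinearMap.id ∧ f.f2 = c • LinearMap.id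

/-- The simple representation `S(1)`, with dimension vector `(1, 0)`. -/
def simple1 (k : Type u) [Field k] (r : ℕ) : KRep k r where
  V1 := k
  V2 := PUnit
  ψ := 0

/-- The simple representation `S(2)`, with dimension vector `(0, 1)`. -/
def simple2 (k : Type u) [Field k] (r : ℕ) : KRep k r where
  V1 := PUnit
  V2 := k
  ψ := 0

/-- Irreducible morphisms: neither a split monomorphism nor a split epimorphism, and every
factorization has a split monomorphism as first or a split epimorphism as second factor. -/
def IsIrreducibleHom {M N : KRep k r} (f : M ⟶ N) : Prop :=
  ¬ IsSplitMono f ∧ ¬ IsSplitEpi f ∧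
    ∀ (L : KRep k r) (g : M ⟶ L) (h : L ⟶ N), g ≫ h = f → IsSplitMono g ∨ IsSplitEpi h

/-- There is an arrow `M → N` in the Auslander-Reiten quiver of `K_r`. -/
def ARArrow (M N : KRep k r) : Prop :=
  Indecomposable M ∧ Indecomposable N ∧ ∃ f : M ⟶ N, IsIrreducibleHom f

/-- For indecomposable `M` and `N`: their isomorphism classes lie in the same connected component
of the Auslander-Reiten quiver of `K_r`. -/
def SameARComponent (M N : KRep k r) : Prop :=
  Relation.ReflTransGen
    (fun L L' : KRep k r => ARArrow L L' ∨ ARArrow L' L ∨ Nonempty (L ≅ L')) M N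

/-- `M` is indecomposable preprojective: it lies in the component of `S(2)`. -/
def IsIndecPreprojective (M : KRep k r) : Prop :=
  Indecomposable M ∧ SameARComponent (simple2 k r) M

/-- `M` is indecomposable preinjective: it lies in the component of `S(1)`. -/
def IsIndecPreinjective (M : KRep k r) : Prop :=
  Indecomposable M ∧ SameARComponent (simple1 k r) M

/-- `M` is regular: every indecomposable direct summand of `M` lies in a component of the
Auslander-Reiten quiver that is neither the preprojective nor the preinjective one. -/
def IsRegular (M : KRep k r) : Prop :=
  ∀ N N' : KRep k r, Nonempty (M ≅ N ⊞ N') → Indecomposable N →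
    ¬ IsIndecPreprojective N ∧ ¬ IsIndecPreinjective N

/-- The restriction `α^*(M)` of `M` along a linear map `α : A_d → A_r`. -/
def restrict {d : ℕ} (α : ArrowSpace k d →ₗ[k] ArrowSpace k r) (M : KRep k r) : KRep k d where
  V1 := M.V1
  V2 := M.V2
  ψ := M.ψ ∘ₗ α.rTensor M.V1

end KRep

/-- The Grassmannian `Gr_d(A_r)` of `d`-dimensional subspaces of `A_r`. -/
def KGr (k : Type u) [Field k] (d r : ℕ) : Type u :=
  {v : Submodule k (ArrowSpace k r) // Module.finrank k v = d}

namespace KRep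

variable {k : Type u} [Field k] {r : ℕ}

/-- The `d`-th rank variety `𝒱(K_r, d)_M`: the set of all `v ∈ Gr_d(A_r)` such that `α^*(M)` is
not projective in `rep(K_d)` for all injective `α : A_d → A_r` with image `v`. -/
def rankVariety (M : KRep k r) (d : ℕ) : Set (KGr k d r) :=
  {v | ∀ α : ArrowSpace k d →ₗ[k] ArrowSpace k r,
    Function.Injective α → LinearMap.range α = v.1 → ¬ Projective (restrict α M)}

/-- `M` is relative `d`-projective. -/
def IsRelProjective (M : KRep k r) (d : ℕ) : Prop :=
  M.rankVariety d = ∅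

end KRep

/-! An r × d matrix `α` of rank d gives a representation of dimension vector (d, rd - 1): divide the
free representation on k^d by the one relation `α` in k^r ⊗ k^d. A restriction along an injective
`a` fails to be projective exactly when a nonzero relation lies in im a ⊗ V1. For the single
relation `α` and dim im a ≤ d this means that im a is the column space of `α`. An equation `α_s * G
= c • α_t` with c ≠ 0 equates column spaces, so these representations are bricks, Hom-orthogonal for
distinct column spaces. The group Ext¹ from the one at `α_0` to the one at `α_s` is the space of r ×
d matrices modulo `α_s` and `α_0 * B`, of dimension N = d(r - d) - 1.

Choose a subspace v₀ outside X. Then E_X is the extension of the representation at v₀ by N copies of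
the representation at each v in X, with cocycle a basis of each Ext¹. Independence of the cocycle
does two things. It prevents any relation with nonzero v₀-coefficient from lying in im a ⊗ V1, so v₀
does not enter the rank variety (`exists_range_eq_of_not_projective`), and it forces every
endomorphism to be one scalar on all blocks (`exists_scalar_of_preserves`).

For regularity, the Tits form at m(d, rd - 1) is m²(1 - d(r - d)) ≤ 0, while it is 1 on the
components of S(1) and S(2). The latter holds because the reflection at the sink preserves the form,
is fully faithful away from S(2), and preserves and reflects irreducible maps. Hence everything
reached from S(2) or S(1) by irreducible maps is linked to it by finitely many reflections
(`exists_isPreproj`, `exists_isPreinj`). -/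

namespace KRep

variable {k : Type u} [Field k] {r : ℕ}

/-! ### Representations in coordinates -/

/-- The action of the `i`-th arrow. -/
noncomputable def arr (M : KRep k r) (i : Fin r) : M.V1 →ₗ[k] M.V2 :=
  M.ψ ∘ₗ TensorProduct.mk k (ArrowSpace k r) M.V1 (Pi.single i 1)

theorem arr_apply (M : KRep k r) (i : Fin r) (x : M.V1) :
    M.arr i x = M.ψ (Pi.single i 1 ⊗ₜ x) := rfl

theorem ψ_tmul (M : KRep k r) (a : ArrowSpace k r) (x : M.V1) :
    M.ψ (a ⊗ₜ x) = ∑ i, a i • M.arr i x := by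
  conv_lhs => rw [← Finset.univ_sum_single a]
  rw [TensorProduct.sum_tmul, map_sum]
  refine Finset.sum_congr rfl fun i _ => ?_
  rw [arr_apply, ← map_smul, TensorProduct.smul_tmul', ← Pi.single_smul, smul_eq_mul, mul_one]

/-- The representation with given arrow actions. -/
noncomputable def ofArr (V1 V2 : Type u) [AddCommGroup V1] [AddCommGroup V2] [Module k V1]
    [Module k V2] [FiniteDimensional k V1] [FiniteDimensional k V2]
    (a : Fin r → V1 →ₗ[k] V2) : KRep k r where
  V1 := V1
  V2 := V2
  ψ := TensorProduct.lift (Fintype.linearCombination k a)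

theorem ofArr_arr (V1 V2 : Type u) [AddCommGroup V1] [AddCommGroup V2] [Module k V1]
    [Module k V2] [FiniteDimensional k V1] [FiniteDimensional k V2]
    (a : Fin r → V1 →ₗ[k] V2) (i : Fin r) : (ofArr V1 V2 a).arr i = a i := by
  have h (x : V1) : TensorProduct.lift (Fintype.linearCombination k a)
      (Pi.single i (1 : k) ⊗ₜ[k] x) = a i x := by
    rw [TensorProduct.lift.tmul, Fintype.linearCombination_apply_single, one_smul]
  exact LinearMap.ext h

theorem hom_arr {M N : KRep k r} (f : M ⟶ N) (i : Fin r) (x : M.V1) :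
    f.f2 (M.arr i x) = N.arr i (f.f1 x) := by
  have := LinearMap.congr_fun f.comm (Pi.single i 1 ⊗ₜ x)
  simpa [arr_apply] using this

/-- A morphism from a pair of linear maps commuting with all arrows. -/
def homMk {M N : KRep k r} (f1 : M.V1 →ₗ[k] N.V1) (f2 : M.V2 →ₗ[k] N.V2)
    (h : ∀ i x, f2 (M.arr i x) = N.arr i (f1 x)) : M ⟶ N :=
  ⟨f1, f2, TensorProduct.ext' fun a x => by simp [ψ_tmul, h]⟩

@[simp]
theorem homMk_f1 {M N : KRep k r} (f1 : M.V1 →ₗ[k] N.V1) (f2 : M.V2 →ₗ[k] N.V2)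
    (h : ∀ i x, f2 (M.arr i x) = N.arr i (f1 x)) : (homMk f1 f2 h).f1 = f1 := rfl

@[simp]
theorem homMk_f2 {M N : KRep k r} (f1 : M.V1 →ₗ[k] N.V1) (f2 : M.V2 →ₗ[k] N.V2)
    (h : ∀ i x, f2 (M.arr i x) = N.arr i (f1 x)) : (homMk f1 f2 h).f2 = f2 := rfl

/-- The structure map in coordinates. -/
noncomputable def row (M : KRep k r) : (Fin r → M.V1) →ₗ[k] M.V2 :=
  ∑ i, M.arr i ∘ₗ LinearMap.proj i

theorem row_apply (M : KRep k r) (x : Fin r → M.V1) : M.row x = ∑ i, M.arr i (x i) := by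
  simp [row]

/-- The adjoint structure map in coordinates. -/
noncomputable def col (M : KRep k r) : M.V1 →ₗ[k] (Fin r → M.V2) := LinearMap.pi M.arr

@[simp]
theorem col_apply (M : KRep k r) (x : M.V1) (i : Fin r) : M.col x i = M.arr i x := rfl

theorem hom_row {M N : KRep k r} (f : M ⟶ N) (x : Fin r → M.V1) :
    f.f2 (M.row x) = N.row (fun i => f.f1 (x i)) := by
  simp [row_apply, hom_arr]

/-- Coordinates on `A_r ⊗ V`. -/
noncomputable def tensorCoord (V : Type u) [AddCommGroup V] [Module k V] :
    ArrowSpace k r ⊗[k] V ≃ₗ[k] (Fin r → V) :=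
  (TensorProduct.comm k _ _).trans (TensorProduct.piScalarRight k k V (Fin r))

theorem tensorCoord_tmul (V : Type u) [AddCommGroup V] [Module k V] (a : ArrowSpace k r) (x : V)
    (i : Fin r) : tensorCoord V (a ⊗ₜ[k] x) i = a i • x := by
  simp [tensorCoord]

theorem row_tensorCoord (M : KRep k r) : M.row ∘ₗ (tensorCoord M.V1).toLinearMap = M.ψ :=
  TensorProduct.ext' fun a x => by simp [row_apply, tensorCoord_tmul, ψ_tmul]

theorem row_injective_iff (M : KRep k r) :
    Function.Injective M.row ↔ Function.Injective M.ψ := by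
  rw [← row_tensorCoord]
  exact ((tensorCoord M.V1).injective_comp M.row).symm

theorem isZero_iff (M : KRep k r) : IsZero M ↔ Subsingleton M.V1 ∧ Subsingleton M.V2 := by
  rw [IsZero.iff_id_eq_zero]
  constructor
  · intro h
    have h1 := congrArg Hom.f1 h
    have h2 := congrArg Hom.f2 h
    exact ⟨⟨fun x y => (LinearMap.congr_fun h1 x).trans (LinearMap.congr_fun h1 y).symm⟩,
      ⟨fun x y => (LinearMap.congr_fun h2 x).trans (LinearMap.congr_fun h2 y).symm⟩⟩
  · rintro ⟨h1, h2⟩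
    exact hom_ext (LinearMap.ext fun x => Subsingleton.elim _ _)
      (LinearMap.ext fun x => Subsingleton.elim _ _)

/-- The isomorphism given by a morphism with bijective components. -/
theorem isIso_of_bijective {M N : KRep k r} (f : M ⟶ N) (h1 : Function.Bijective f.f1)
    (h2 : Function.Bijective f.f2) : IsIso f := by
  let e1 := LinearEquiv.ofBijective f.f1 h1
  let e2 := LinearEquiv.ofBijective f.f2 h2
  refine ⟨⟨homMk e1.symm.toLinearMap e2.symm.toLinearMap fun i x => ?_, ?_, ?_⟩⟩
  · obtain ⟨y, rfl⟩ := e1.surjective x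
    simp only [LinearEquiv.coe_coe, LinearEquiv.symm_apply_apply]
    rw [LinearEquiv.symm_apply_eq]
    exact (hom_arr f i y).symm
  · exact hom_ext (LinearMap.ext fun x => e1.symm_apply_apply x)
      (LinearMap.ext fun x => e2.symm_apply_apply x)
  · exact hom_ext (LinearMap.ext fun x => e1.apply_symm_apply x)
      (LinearMap.ext fun x => e2.apply_symm_apply x)

section Iso

variable {M N : KRep k r} (e : M ≅ N)

/-- The first component of an isomorphism. -/
def isoV1 : M.V1 ≃ₗ[k] N.V1 :=
  LinearEquiv.ofLinearMap e.hom.f1 e.inv.f1 (congrArg Hom.f1 e.inv_hom_id)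
    (congrArg Hom.f1 e.hom_inv_id)

/-- The second component of an isomorphism. -/
def isoV2 : M.V2 ≃ₗ[k] N.V2 :=
  LinearEquiv.ofLinearMap e.hom.f2 e.inv.f2 (congrArg Hom.f2 e.inv_hom_id)
    (congrArg Hom.f2 e.hom_inv_id)

theorem dimVector_eq_of_iso {M N : KRep k r} (e : M ≅ N) : M.dimVector = N.dimVector :=
  Prod.ext (isoV1 e).finrank_eq (isoV2 e).finrank_eq

end Iso

/-! ### Epimorphisms and projective representations -/

theorem exists_dual_ne_zero {V : Type u} [AddCommGroup V] [Module k V] (W : Submodule k V)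
    (x : V) (hx : x ∉ W) : ∃ φ : V →ₗ[k] k, φ x = 1 ∧ ∀ y ∈ W, φ y = 0 := by
  obtain ⟨φ, h1, h2⟩ := Submodule.exists_dual_map_eq_bot_of_notMem hx inferInstance
  refine ⟨(φ x)⁻¹ • φ, by simp [h1], fun y hy => ?_⟩
  have : φ y ∈ W.map φ := ⟨y, hy, rfl⟩
  rw [h2, Submodule.mem_bot] at this
  simp [this]

theorem surjective_of_epi {M N : KRep k r} (f : M ⟶ N) [Epi f] :
    Function.Surjective f.f1 ∧ Function.Surjective f.f2 := by
  constructor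
  · rw [← LinearMap.range_eq_top, Submodule.eq_top_iff']
    intro x
    by_contra hx
    obtain ⟨φ, h1, h2⟩ := exists_dual_ne_zero _ x hx
    let g : N ⟶ simple1 k r := homMk φ 0 fun i y => rfl
    have : f ≫ g = f ≫ 0 := hom_ext
      (LinearMap.ext fun y => h2 _ ⟨y, rfl⟩) (LinearMap.ext fun y => rfl)
    have h3 := LinearMap.congr_fun (congrArg Hom.f1 ((cancel_epi f).1 this)) x
    exact one_ne_zero (α := k) (h1.symm.trans h3)
  · rw [← LinearMap.range_eq_top, Submodule.eq_top_iff']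
    intro x
    by_contra hx
    obtain ⟨φ, h1, h2⟩ := exists_dual_ne_zero _ x hx
    -- The injective envelope of S(2): every functional on `N.V2` extends uniquely to a morphism
    -- into it, so it detects the cokernel at vertex 2, as S(1) does at vertex 1.
    let I : KRep k r := ofArr (Fin r → k) k fun i => LinearMap.proj i
    let g : N ⟶ I := homMk (LinearMap.pi fun i => φ ∘ₗ N.arr i) φ fun i y => by
      change _ = (ofArr (Fin r → k) k fun i => LinearMap.proj i).arr i _
      rw [ofArr_arr]; rfl
    have : f ≫ g = f ≫ 0 := hom_ext
      (LinearMap.ext fun y => funext fun i => by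
        change φ (N.arr i (f.f1 y)) = 0
        rw [← hom_arr]
        exact h2 _ ⟨_, rfl⟩)
      (LinearMap.ext fun y => h2 _ ⟨y, rfl⟩)
    have h3 := LinearMap.congr_fun (congrArg Hom.f2 ((cancel_epi f).1 this)) x
    exact one_ne_zero (α := k) (h1.symm.trans h3)

theorem epi_of_surjective {M N : KRep k r} (f : M ⟶ N) (h1 : Function.Surjective f.f1)
    (h2 : Function.Surjective f.f2) : Epi f := by
  refine ⟨fun g h e => hom_ext (LinearMap.ext fun x => ?_) (LinearMap.ext fun x => ?_)⟩
  · obtain ⟨y, rfl⟩ := h1 x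
    exact LinearMap.congr_fun (congrArg Hom.f1 e) y
  · obtain ⟨y, rfl⟩ := h2 x
    exact LinearMap.congr_fun (congrArg Hom.f2 e) y

theorem projective_of_injective (M : KRep k r) (h : Function.Injective M.ψ) : Projective M := by
  refine ⟨fun {X Y} f e _ => ?_⟩
  obtain ⟨s1, s2⟩ := surjective_of_epi e
  obtain ⟨g1, hg1⟩ := Module.projective_lifting_property e.f1 f.f1 s1
  obtain ⟨g2, hg2⟩ := Module.projective_lifting_property e.f2 f.f2 s2
  obtain ⟨π, hπ⟩ := M.ψ.exists_leftInverse_of_injective (LinearMap.ker_eq_bot.2 h)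
  -- The vector space lifts need not commute with the structure maps. The defect is extended from
  -- the image of `M.ψ` by the retraction `π` and added to `g2`; it dies under `e.f2`, so the lift
  -- survives.
  refine ⟨⟨g1, g2 + (X.ψ ∘ₗ g1.lTensor _ - g2 ∘ₗ M.ψ) ∘ₗ π, ?_⟩, hom_ext hg1 ?_⟩
  · rw [LinearMap.add_comp, LinearMap.comp_assoc M.ψ, hπ, LinearMap.comp_id]
    abel
  · have : e.f2 ∘ₗ (X.ψ ∘ₗ g1.lTensor _ - g2 ∘ₗ M.ψ) = 0 := by
      rw [LinearMap.comp_sub, ← LinearMap.comp_assoc, ← LinearMap.comp_assoc, hg2, e.comm, f.comm,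
        LinearMap.comp_assoc, ← LinearMap.lTensor_comp, hg1, sub_self]
    rw [comp_f2, LinearMap.comp_add, ← LinearMap.comp_assoc, this, LinearMap.zero_comp, add_zero,
      hg2]

/-- Split the cover of `M` whose structure map is the inclusion of A_r ⊗ V1: since the section is
the identity on V1, that inclusion factors through `M.ψ`. -/
theorem injective_of_projective (M : KRep k r) [Projective M] : Function.Injective M.ψ := by
  let P : KRep k r :=
    { V1 := M.V1
      V2 := (ArrowSpace k r ⊗[k] M.V1) × M.V2
      ψ := LinearMap.inl k _ _ }
  let p : P ⟶ M := ⟨LinearMap.id, M.ψ.coprod LinearMap.id, by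
    simp [P]⟩
  have : Epi p := epi_of_surjective p (fun x => ⟨x, rfl⟩) (fun x => ⟨(0, x), by
    change M.ψ 0 + x = x
    rw [map_zero, zero_add]⟩)
  have hs : Projective.factorThru (𝟙 M) p ≫ p = 𝟙 M := Projective.factorThru_comp _ _
  set s := Projective.factorThru (𝟙 M) p
  have h1 : s.f1 = LinearMap.id := congrArg Hom.f1 hs
  have h2 : s.f2 ∘ₗ M.ψ = LinearMap.inl k _ _ := by
    have := s.comm
    rw [h1] at this
    refine this.trans ?_
    erw [LinearMap.lTensor_id]
    rfl
  have h3 : Function.Injective (s.f2 ∘ₗ M.ψ) := by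
    rw [h2]; exact LinearMap.inl_injective
  exact Function.Injective.of_comp (f := s.f2) h3

theorem projective_iff (M : KRep k r) : Projective M ↔ Function.Injective M.ψ :=
  ⟨fun _ => injective_of_projective M, projective_of_injective M⟩

end KRep

namespace KRep

variable {k : Type u} [Field k] {r : ℕ}

/-! ### Idempotents and the simple summands -/

theorem isSplitMono_of_comp {M N L : KRep k r} {f : M ⟶ N} {g : N ⟶ L}
    (h : IsSplitMono (f ≫ g)) : IsSplitMono f :=
  ⟨⟨⟨g ≫ retraction (f ≫ g), by rw [← Category.assoc, IsSplitMono.id]⟩⟩⟩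

theorem isSplitEpi_of_comp {M N L : KRep k r} {f : M ⟶ N} {g : N ⟶ L}
    (h : IsSplitEpi (f ≫ g)) : IsSplitEpi g :=
  ⟨⟨⟨section_ (f ≫ g) ≫ f, by rw [Category.assoc, IsSplitEpi.id]⟩⟩⟩

/-- Non-zero representations without non-trivial idempotent endomorphisms. -/
def HasTrivialIdempotents (M : KRep k r) : Prop :=
  ¬ IsZero M ∧ ∀ e : M ⟶ M, e ≫ e = e → e = 0 ∨ e = 𝟙 M

theorem exists_splitting {M : KRep k r} (e : M ⟶ M) (he : e ≫ e = e) :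
    ∃ (Y : KRep k r) (p : M ⟶ Y) (i : Y ⟶ M), p ≫ i = e ∧ i ≫ p = 𝟙 Y := by
  have key (i : Fin r) : ∀ x ∈ LinearMap.range e.f1, M.arr i x ∈ LinearMap.range e.f2 := by
    rintro _ ⟨x, rfl⟩
    exact ⟨M.arr i x, hom_arr e i x⟩
  let Y : KRep k r := ofArr (LinearMap.range e.f1) (LinearMap.range e.f2)
    fun i => (M.arr i).restrict (key i)
  have hY (i : Fin r) (x : LinearMap.range e.f1) :
      Y.arr i x = (⟨M.arr i x.1, key i _ x.2⟩ : LinearMap.range e.f2) := by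
    rw [ofArr_arr]; rfl
  refine ⟨Y, homMk e.f1.rangeRestrict e.f2.rangeRestrict fun i x => ?_,
    homMk (LinearMap.range e.f1).subtype (LinearMap.range e.f2).subtype fun i x => ?_, ?_, ?_⟩
  · exact Eq.trans (b := (⟨M.arr i (e.f1 x), key i _ ⟨x, rfl⟩⟩ : LinearMap.range e.f2))
      (Subtype.ext (hom_arr e i x)) (hY i (e.f1.rangeRestrict x)).symm
  · exact congrArg Subtype.val (hY i x)
  · exact hom_ext (LinearMap.ext fun x => rfl) (LinearMap.ext fun x => rfl)
  · refine hom_ext (LinearMap.ext ?_) (LinearMap.ext ?_)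
    · rintro ⟨_, x, rfl⟩
      exact Subtype.ext (LinearMap.congr_fun (congrArg Hom.f1 he) x)
    · rintro ⟨_, x, rfl⟩
      exact Subtype.ext (LinearMap.congr_fun (congrArg Hom.f2 he) x)

/-- Idempotents split. The idempotent condition is the form of indecomposability that a fully
faithful reflection transports directly. -/
theorem hasTrivialIdempotents_of_indecomposable {M : KRep k r} (h : Indecomposable M) :
    HasTrivialIdempotents M := by
  refine ⟨h.1, fun e he => ?_⟩
  have he' : (𝟙 M - e) ≫ (𝟙 M - e) = 𝟙 M - e := by
    simp [Preadditive.sub_comp, Preadditive.comp_sub, he]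
  obtain ⟨Y, p, i, h1, h2⟩ := exists_splitting e he
  obtain ⟨Z, q, j, h3, h4⟩ := exists_splitting _ he'
  have hiq : i ≫ q = 0 := by
    have : i ≫ q = (i ≫ p) ≫ i ≫ q ≫ j ≫ q := by simp [h2, h4]
    rw [this]
    have : p ≫ i ≫ q ≫ j = 0 := by
      rw [h3, ← Category.assoc, h1]; simp [Preadditive.comp_sub, he]
    simp only [Category.assoc] at this ⊢
    rw [reassoc_of% this]; simp
  have hjp : j ≫ p = 0 := by
    have : j ≫ p = (j ≫ q) ≫ j ≫ p ≫ i ≫ p := by simp [h2, h4]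
    rw [this]
    have : q ≫ j ≫ p ≫ i = 0 := by
      rw [h1, ← Category.assoc, h3]; simp [Preadditive.sub_comp, he]
    simp only [Category.assoc] at this ⊢
    rw [reassoc_of% this]; simp
  let φ : M ≅ Y ⊞ Z :=
    { hom := biprod.lift p q
      inv := biprod.desc i j
      hom_inv_id := by simp [h1, h3]
      inv_hom_id := by
        refine biprod.hom_ext' _ _ (biprod.hom_ext _ _ ?_ ?_) (biprod.hom_ext _ _ ?_ ?_) <;>
          simp [h2, h4, hiq, hjp] }
  rcases h.2 Y Z φ with hz | hz
  · left; rw [← h1, hz.eq_of_tgt p 0]; simp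
  · right
    have : 𝟙 M - e = 0 := by rw [← h3, hz.eq_of_tgt q 0]; simp
    exact (sub_eq_zero.1 this).symm

theorem HasTrivialIdempotents.of_iso {M N : KRep k r} (φ : M ≅ N)
    (h : HasTrivialIdempotents M) : HasTrivialIdempotents N := by
  refine ⟨fun hN => h.1 (hN.of_iso φ), fun e he => ?_⟩
  rcases h.2 (φ.hom ≫ e ≫ φ.inv) (by simp [reassoc_of% he]) with h0 | h0
  · left
    have : φ.inv ≫ (φ.hom ≫ e ≫ φ.inv) ≫ φ.hom = 0 := by rw [h0]; simp
    simpa using this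
  · right
    have : φ.inv ≫ (φ.hom ≫ e ≫ φ.inv) ≫ φ.hom = 𝟙 N := by rw [h0]; simp
    simpa using this

theorem bijective_of_eq_smul {V : Type u} [AddCommGroup V] [Module k V] (φ : V →ₗ[k] k) (x : V)
    (h1 : φ x = 1) (h : ∀ y, y = φ y • x) : Function.Bijective φ := by
  constructor
  · intro y z hyz
    rw [h y, h z, hyz]
  · intro c
    exact ⟨c • x, by simp [h1]⟩

/-- A vector outside the image of the arrows spans a direct summand S(2); the projection onto it is
a nonzero idempotent, hence the identity. -/
theorem row_surjective_or {M : KRep k r} (h : HasTrivialIdempotents M) :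
    Function.Surjective M.row ∨ Nonempty (M ≅ simple2 k r) := by
  rw [or_iff_not_imp_left, ← LinearMap.range_eq_top, Submodule.eq_top_iff']
  intro hx
  push Not at hx
  obtain ⟨x, hx⟩ := hx
  obtain ⟨φ, h1, h2⟩ := exists_dual_ne_zero _ x hx
  have h3 (i y) : φ (M.arr i y) = 0 :=
    h2 _ ⟨Pi.single i y, by simp [row_apply, Pi.single_apply, apply_ite]⟩
  let e : M ⟶ M := homMk 0 (φ.smulRight x) fun i y => by simp [h3]
  rcases h.2 e (hom_ext (LinearMap.ext fun y => rfl)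
    (LinearMap.ext fun y => by simp [e, h1])) with h0 | h0
  · have := LinearMap.congr_fun (congrArg Hom.f2 h0) x
    have hx0 : x = 0 := by simpa [e, h1] using this
    simp [hx0] at h1
  · have e1 (y : M.V1) : y = 0 := (LinearMap.congr_fun (congrArg Hom.f1 h0) y).symm
    have e2 (y : M.V2) : y = φ y • x := (LinearMap.congr_fun (congrArg Hom.f2 h0) y).symm
    let f : M ⟶ simple2 k r := homMk 0 φ fun i y => (h3 i y).trans rfl
    have : IsIso f := isIso_of_bijective f
      ⟨fun y z _ => (e1 y).trans (e1 z).symm, fun y => ⟨0, rfl⟩⟩ (bijective_of_eq_smul φ x h1 e2)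
    exact ⟨asIso f⟩

theorem col_injective_or {M : KRep k r} (h : HasTrivialIdempotents M) :
    Function.Injective M.col ∨ Nonempty (M ≅ simple1 k r) := by
  rw [or_iff_not_imp_left, injective_iff_map_eq_zero]
  intro hx
  push Not at hx
  obtain ⟨x, hx, hx0⟩ := hx
  obtain ⟨φ, h1, -⟩ := exists_dual_ne_zero (⊥ : Submodule k M.V1) x hx0
  have h3 (i) : M.arr i x = 0 := congrFun hx i
  let e : M ⟶ M := homMk (φ.smulRight x) 0 fun i y => by simp [h3]
  rcases h.2 e (hom_ext (LinearMap.ext fun y => by simp [e, h1])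
    (LinearMap.ext fun y => rfl)) with h0 | h0
  · have := LinearMap.congr_fun (congrArg Hom.f1 h0) x
    exact absurd (by simpa [e, h1] using this) hx0
  · have e2 (y : M.V2) : y = 0 := (LinearMap.congr_fun (congrArg Hom.f2 h0) y).symm
    have e1 (y : M.V1) : y = φ y • x := (LinearMap.congr_fun (congrArg Hom.f1 h0) y).symm
    let f : M ⟶ simple1 k r := homMk φ 0 fun i y => rfl
    have : IsIso f := isIso_of_bijective f (bijective_of_eq_smul φ x h1 e1)
      ⟨fun y z _ => (e2 y).trans (e2 z).symm, fun y => ⟨0, rfl⟩⟩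
    exact ⟨asIso f⟩

/-! ### The reflection functor -/

/-- The Bernstein-Gelfand-Ponomarev reflection of `M` at its sink, with the kernel of the
structure map as first and `M.V1` as second vector space. -/
noncomputable def refl (M : KRep k r) : KRep k r :=
  ofArr (LinearMap.ker M.row) M.V1 fun i => LinearMap.proj i ∘ₗ (LinearMap.ker M.row).subtype

theorem refl_arr (M : KRep k r) (i : Fin r) (x : LinearMap.ker M.row) :
    M.refl.arr i x = x.1 i := by
  unfold refl
  rw [ofArr_arr]; rfl

theorem refl_col_injective (M : KRep k r) : Function.Injective M.refl.col := by
  intro x y h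
  refine Subtype.ext (funext fun i => ?_)
  exact (refl_arr M i x).symm.trans ((congrFun h i).trans (refl_arr M i y))

/-- The reflection of a morphism. -/
noncomputable def reflMap {M N : KRep k r} (f : M ⟶ N) : M.refl ⟶ N.refl :=
  homMk ((f.f1.compLeft (Fin r)).restrict (p := LinearMap.ker M.row) (q := LinearMap.ker N.row)
    fun x hx => by
      rw [LinearMap.mem_ker] at hx ⊢
      exact (hom_row f x).symm.trans (by rw [hx, map_zero])) f.f1 fun i x =>
    (congrArg f.f1 (refl_arr M i x)).trans (refl_arr N i
      ((f.f1.compLeft (Fin r)).restrict (p := LinearMap.ker M.row) (q := LinearMap.ker N.row)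
        _ x)).symm

/-- The arrows of a reflection are jointly injective, so the component at the sink determines the
other one. -/
theorem refl_hom_ext {M N : KRep k r} {f g : M ⟶ N.refl} (h : f.f2 = g.f2) : f = g := by
  refine hom_ext (LinearMap.ext fun x => refl_col_injective N (funext fun i => ?_)) h
  rw [col_apply, col_apply, ← hom_arr, ← hom_arr, h]

theorem reflMap_id (M : KRep k r) : reflMap (𝟙 M) = 𝟙 M.refl := refl_hom_ext rfl

theorem reflMap_comp {M N L : KRep k r} (f : M ⟶ N) (g : N ⟶ L) :
    reflMap (f ≫ g) = reflMap f ≫ reflMap g := refl_hom_ext rfl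

theorem reflMap_injective {M N : KRep k r} (hM : Function.Surjective M.row) {f g : M ⟶ N}
    (h : reflMap f = reflMap g) : f = g := by
  have h1 : f.f1 = g.f1 := congrArg Hom.f2 h
  refine hom_ext h1 (LinearMap.ext fun x => ?_)
  obtain ⟨y, rfl⟩ := hM x
  rw [hom_row, hom_row, h1]

theorem exists_hom_of_f1 {M N : KRep k r} (hM : Function.Surjective M.row)
    (f1 : M.V1 →ₗ[k] N.V1) (h : ∀ x, M.row x = 0 → N.row (fun i => f1 (x i)) = 0) :
    ∃ f : M ⟶ N, f.f1 = f1 := by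
  obtain ⟨s, hs⟩ := M.row.exists_rightInverse_of_surjective (LinearMap.range_eq_top.2 hM)
  refine ⟨homMk f1 (N.row ∘ₗ f1.compLeft (Fin r) ∘ₗ s) fun i x => ?_, rfl⟩
  have h1 : M.row (Pi.single i x) = M.arr i x := by
    simp [row_apply, Pi.single_apply, apply_ite]
  have h2 : M.row (s (M.arr i x) - Pi.single i x) = 0 := by
    rw [map_sub, h1, sub_eq_zero]
    exact LinearMap.congr_fun hs _
  have h3 := h _ h2
  have h4 : (fun j => f1 ((s (M.arr i x) - Pi.single i x : Fin r → M.V1) j)) =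
      f1.compLeft (Fin r) (s (M.arr i x)) - Pi.single i (f1 x) := by
    ext j
    by_cases hj : j = i
    · subst hj; simp
    · simp [hj]
  rw [h4, map_sub, sub_eq_zero] at h3
  refine h3.trans ?_
  simp [row_apply, Pi.single_apply, apply_ite]

/-- Fullness: compatibility of `g` with the arrows says that `g.f2` carries relations of `M` to
relations of `N`, and `M.V2` is the quotient by its relations. -/
theorem reflMap_surjective {M N : KRep k r} (hM : Function.Surjective M.row)
    (g : M.refl ⟶ N.refl) : ∃ f : M ⟶ N, reflMap f = g := by
  obtain ⟨f, hf⟩ := exists_hom_of_f1 (N := N) hM g.f2 fun x hx => by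
    have h : ∀ i, g.f2 (x i) = (g.f1 ⟨x, hx⟩ : LinearMap.ker N.row).1 i := fun i =>
      (congrArg g.f2 (refl_arr M i ⟨x, hx⟩)).symm.trans ((hom_arr g i _).trans (refl_arr N i _))
    have h' : (fun i => g.f2 (x i)) = (g.f1 ⟨x, hx⟩ : LinearMap.ker N.row).1 := funext h
    exact (congrArg N.row h').trans (g.f1 ⟨x, hx⟩ : LinearMap.ker N.row).2
  exact ⟨f, refl_hom_ext hf⟩

/-- The quotient of the projective representation with `V` in the source by a subspace `K` of
relations in the sink. -/
noncomputable abbrev ofRelations (V : Type u) [AddCommGroup V] [Module k V] [FiniteDimensional k V]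
    (K : Submodule k (Fin r → V)) : KRep k r :=
  ofArr V ((Fin r → V) ⧸ K) fun i => K.mkQ ∘ₗ LinearMap.single k (fun _ => V) i

theorem ofRelations_row (V : Type u) [AddCommGroup V] [Module k V] [FiniteDimensional k V]
    (K : Submodule k (Fin r → V)) : (ofRelations V K).row = K.mkQ := by
  refine LinearMap.ext fun x => ?_
  rw [row_apply]
  have h (i) : (ofRelations V K).arr i (x i) = K.mkQ (Pi.single i (x i)) := by
    rw [ofArr_arr]; rfl
  rw [Finset.sum_congr rfl fun i _ => h i]
  refine (map_sum _ _ _).symm.trans ?_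
  exact congrArg K.mkQ (Finset.univ_sum_single (f := x))

/-- The inverse reflection: the new sink space is the cokernel of `L.col`, whose kernel of relations
recovers `L.V1`. -/
theorem exists_refl_iso (L : KRep k r) (hL : Function.Injective L.col) :
    ∃ L' : KRep k r, Function.Surjective L'.row ∧ Nonempty (L'.refl ≅ L) := by
  let L' : KRep k r := ofRelations L.V2 (LinearMap.range L.col)
  have hrow : L'.row = (LinearMap.range L.col).mkQ := ofRelations_row _ _
  have hker : LinearMap.ker L'.row = LinearMap.range L.col := by
    rw [hrow]
    exact Submodule.ker_mkQ _
  refine ⟨L', ?_, ?_⟩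
  · intro y
    obtain ⟨x, hx⟩ := Submodule.mkQ_surjective (LinearMap.range L.col) y
    exact ⟨x, (LinearMap.congr_fun hrow x).trans hx⟩
  · let f : L ⟶ L'.refl := homMk (LinearMap.codRestrict (LinearMap.ker L'.row) L.col
      fun x => by rw [hker]; exact ⟨x, rfl⟩) LinearMap.id fun i x =>
        (refl_arr L' i ((LinearMap.codRestrict (LinearMap.ker L'.row) L.col _) x)).symm
    have : IsIso f := isIso_of_bijective f
      ⟨fun x y h => hL (congrArg Subtype.val h), fun y => by
        obtain ⟨y, hy⟩ := y
        rw [hker] at hy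
        obtain ⟨x, rfl⟩ := hy
        exact ⟨x, rfl⟩⟩ Function.bijective_id
    exact ⟨(asIso f).symm⟩

theorem isSplitMono_reflMap_iff {M N : KRep k r} (hM : Function.Surjective M.row)
    (hN : Function.Surjective N.row) (f : M ⟶ N) : IsSplitMono (reflMap f) ↔ IsSplitMono f := by
  constructor
  · intro h
    obtain ⟨g, hg⟩ := reflMap_surjective hN (retraction (reflMap f))
    exact ⟨⟨⟨g, reflMap_injective hM (by rw [reflMap_comp, hg, IsSplitMono.id, reflMap_id])⟩⟩⟩
  · intro h
    exact ⟨⟨⟨reflMap (retraction f), by rw [← reflMap_comp, IsSplitMono.id, reflMap_id]⟩⟩⟩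

theorem isSplitEpi_reflMap_iff {M N : KRep k r}
    (hN : Function.Surjective N.row) (f : M ⟶ N) : IsSplitEpi (reflMap f) ↔ IsSplitEpi f := by
  constructor
  · intro h
    obtain ⟨g, hg⟩ := reflMap_surjective hN (section_ (reflMap f))
    exact ⟨⟨⟨g, reflMap_injective hN (by rw [reflMap_comp, hg, IsSplitEpi.id, reflMap_id])⟩⟩⟩
  · intro h
    exact ⟨⟨⟨reflMap (section_ f), by rw [← reflMap_comp, IsSplitEpi.id, reflMap_id]⟩⟩⟩

theorem isZero_of_refl {M : KRep k r} (hM : Function.Surjective M.row) (h : IsZero M.refl) :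
    IsZero M := by
  obtain ⟨-, h2⟩ := (isZero_iff _).1 h
  have h2' : Subsingleton M.V1 := h2
  exact (isZero_iff _).2 ⟨h2', hM.subsingleton⟩

theorem HasTrivialIdempotents.refl {M : KRep k r} (hM : Function.Surjective M.row)
    (h : HasTrivialIdempotents M) : HasTrivialIdempotents M.refl := by
  refine ⟨fun h0 => h.1 (isZero_of_refl hM h0), fun e he => ?_⟩
  obtain ⟨f, rfl⟩ := reflMap_surjective hM e
  rw [← reflMap_comp] at he
  rcases h.2 f (reflMap_injective hM he) with rfl | rfl
  · exact Or.inl (refl_hom_ext rfl)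
  · exact Or.inr (reflMap_id M)

theorem HasTrivialIdempotents.of_refl {M : KRep k r} (hM : Function.Surjective M.row)
    (h : HasTrivialIdempotents M.refl) : HasTrivialIdempotents M := by
  refine ⟨fun h0 => h.1 ?_, fun e he => ?_⟩
  · rw [IsZero.iff_id_eq_zero, ← reflMap_id, (IsZero.iff_id_eq_zero M).1 h0]
    exact refl_hom_ext rfl
  · rcases h.2 (reflMap e) (by rw [← reflMap_comp, he]) with h0 | h0
    · exact Or.inl (reflMap_injective hM (h0.trans (refl_hom_ext rfl)))
    · exact Or.inr (reflMap_injective hM (h0.trans (reflMap_id M).symm))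

/-! ### Irreducible morphisms under reflection -/

theorem exists_colInjective_quotient (L : KRep k r) :
    ∃ (L' : KRep k r) (p : L ⟶ L'), Function.Injective L'.col ∧ IsSplitEpi p ∧
      ∀ (N : KRep k r) (_ : Function.Injective N.col) (h : L ⟶ N), ∃ h' : L' ⟶ N, p ≫ h' = h := by
  set K := LinearMap.ker L.col with hK
  have hKa (i) : K ≤ LinearMap.ker (L.arr i) := fun x hx => congrFun (LinearMap.mem_ker.1 hx) i
  let L' : KRep k r := ofArr (L.V1 ⧸ K) L.V2 fun i => K.liftQ (L.arr i) (hKa i)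
  have harr (i x) : L'.arr i (K.mkQ x) = L.arr i x := by
    rw [ofArr_arr]; rfl
  obtain ⟨s, hs⟩ := K.mkQ.exists_rightInverse_of_surjective (Submodule.range_mkQ K)
  let p : L ⟶ L' := homMk K.mkQ LinearMap.id fun i x => (harr i x).symm
  refine ⟨L', p, ?_, ⟨⟨⟨homMk s LinearMap.id fun i x => ?_, ?_⟩⟩⟩, fun N hN h => ?_⟩
  · rw [injective_iff_map_eq_zero]
    intro x hx
    obtain ⟨y, rfl⟩ := K.mkQ_surjective x
    refine (Submodule.Quotient.mk_eq_zero K).2 (LinearMap.mem_ker.2 (funext fun i => ?_))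
    exact (harr i y).symm.trans (congrFun hx i)
  · exact (congrArg (L'.arr i) (LinearMap.congr_fun hs x).symm).trans (harr i (s x))
  · exact hom_ext hs rfl
  · have hle : K ≤ LinearMap.ker h.f1 := fun x hx => by
      refine LinearMap.mem_ker.2 ((injective_iff_map_eq_zero _).1 hN _ (funext fun i => ?_))
      rw [col_apply, ← hom_arr, LinearMap.mem_ker.1 (hKa i hx), map_zero]; rfl
    refine ⟨homMk (K.liftQ h.f1 hle) h.f2 fun i x => ?_, hom_ext (LinearMap.ext fun x => rfl) rfl⟩
    obtain ⟨y, rfl⟩ := K.mkQ_surjective x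
    rw [harr]
    exact hom_arr h i y

theorem exists_rowSurjective_sub (L : KRep k r) :
    ∃ (L' : KRep k r) (j : L' ⟶ L), Function.Surjective L'.row ∧ IsSplitMono j ∧
      ∀ (M : KRep k r) (_ : Function.Surjective M.row) (h : M ⟶ L), ∃ h' : M ⟶ L', h' ≫ j = h := by
  set K := LinearMap.range L.row with hK
  have hKa (i x) : L.arr i x ∈ K :=
    ⟨Pi.single i x, by simp [row_apply, Pi.single_apply, apply_ite]⟩
  let L' : KRep k r := ofArr L.V1 K fun i => (L.arr i).codRestrict K (hKa i)
  have harr (i x) : K.subtype (L'.arr i x) = L.arr i x := by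
    rw [ofArr_arr]; rfl
  obtain ⟨s, hs⟩ := K.subtype.exists_leftInverse_of_injective (Submodule.ker_subtype K)
  let j : L' ⟶ L := homMk LinearMap.id K.subtype fun i x => harr i x
  refine ⟨L', j, ?_, ⟨⟨⟨homMk LinearMap.id s fun i x => ?_, ?_⟩⟩⟩, fun M hM h => ?_⟩
  · rintro ⟨_, x, rfl⟩
    refine ⟨x, Subtype.ext ?_⟩
    exact hom_row j x
  · exact (congrArg s (harr i x)).symm.trans (LinearMap.congr_fun hs _)
  · exact hom_ext rfl hs
  · have hle (x) : h.f2 x ∈ K := by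
      obtain ⟨y, rfl⟩ := hM x
      rw [hom_row]
      exact ⟨_, rfl⟩
    refine ⟨homMk h.f1 (h.f2.codRestrict K hle) fun i x => Subtype.ext ?_,
      hom_ext rfl (LinearMap.ext fun x => rfl)⟩
    exact (hom_arr h i x).trans (harr i _).symm

/-- The middle term of a factorization need not be a reflection. Dividing out its S(1)-summands is a
split epimorphism and makes it one, after which the factorization lifts by full faithfulness. -/
theorem IsIrreducibleHom.refl {M N : KRep k r} (hM : Function.Surjective M.row)
    (hN : Function.Surjective N.row) {f : M ⟶ N} (hf : IsIrreducibleHom f) :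
    IsIrreducibleHom (reflMap f) := by
  obtain ⟨h1, h2, h3⟩ := hf
  refine ⟨mt (isSplitMono_reflMap_iff hM hN f).1 h1, mt (isSplitEpi_reflMap_iff hN f).1 h2,
    fun L g h hgh => ?_⟩
  obtain ⟨L₁, p, hL₁, hp, hfac⟩ := exists_colInjective_quotient L
  obtain ⟨h', rfl⟩ := hfac _ (refl_col_injective N) h
  obtain ⟨L', hL', ⟨φ⟩⟩ := exists_refl_iso L₁ hL₁
  obtain ⟨a, ha⟩ := reflMap_surjective hM (g ≫ p ≫ φ.inv)
  obtain ⟨b, hb⟩ := reflMap_surjective hL' (φ.hom ≫ h')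
  rcases h3 L' a b (reflMap_injective hM (by
    rw [reflMap_comp, ha, hb, ← hgh]; simp)) with h0 | h0
  · rw [← isSplitMono_reflMap_iff hM hL', ha] at h0
    exact Or.inl (isSplitMono_of_comp h0)
  · rw [← isSplitEpi_reflMap_iff hN, hb] at h0
    have := isSplitEpi_of_comp h0
    exact Or.inr inferInstance

/-- Dually, S(2)-summands of the middle term are discarded before reflecting. -/
theorem IsIrreducibleHom.of_refl {M N : KRep k r} (hM : Function.Surjective M.row)
    (hN : Function.Surjective N.row) {f : M ⟶ N} (hf : IsIrreducibleHom (reflMap f)) :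
    IsIrreducibleHom f := by
  obtain ⟨h1, h2, h3⟩ := hf
  refine ⟨mt (isSplitMono_reflMap_iff hM hN f).2 h1, mt (isSplitEpi_reflMap_iff hN f).2 h2,
    fun L g h hgh => ?_⟩
  obtain ⟨L₁, j, hL₁, hj, hfac⟩ := exists_rowSurjective_sub L
  obtain ⟨g', rfl⟩ := hfac _ hM g
  rcases h3 L₁.refl (reflMap g') (reflMap (j ≫ h)) (by
    rw [← reflMap_comp, ← hgh, Category.assoc]) with h0 | h0
  · rw [isSplitMono_reflMap_iff hM hL₁] at h0
    exact Or.inl inferInstance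
  · rw [isSplitEpi_reflMap_iff hN] at h0
    exact Or.inr (isSplitEpi_of_comp h0)

theorem IsIrreducibleHom.comp_iso {M N M' N' : KRep k r} (φ : M' ≅ M) (χ : N ≅ N') {f : M ⟶ N}
    (hf : IsIrreducibleHom f) : IsIrreducibleHom (φ.hom ≫ f ≫ χ.hom) := by
  obtain ⟨h1, h2, h3⟩ := hf
  refine ⟨fun h => h1 ?_, fun h => h2 ?_, fun L g h hgh => ?_⟩
  · have : f = φ.inv ≫ (φ.hom ≫ f ≫ χ.hom) ≫ χ.inv := by simp
    rw [this]; infer_instance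
  · have : f = φ.inv ≫ (φ.hom ≫ f ≫ χ.hom) ≫ χ.inv := by simp
    rw [this]; infer_instance
  · rcases h3 L (φ.inv ≫ g) (h ≫ χ.inv) (by simp [reassoc_of% hgh]) with h0 | h0
    · left
      have : g = φ.hom ≫ φ.inv ≫ g := by simp
      rw [this]; infer_instance
    · right
      have : h = (h ≫ χ.inv) ≫ χ.hom := by simp
      rw [this]; infer_instance

theorem IsIrreducibleHom.ne_zero {M N : KRep k r} {f : M ⟶ N} (hf : IsIrreducibleHom f) :
    f ≠ 0 := by
  rintro rfl
  let Z : KRep k r := ofArr PUnit PUnit fun _ => 0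
  rcases hf.2.2 Z 0 0 (by simp) with h | h
  · have := IsSplitMono.id (0 : M ⟶ Z)
    rw [zero_comp] at this
    exact hf.1 ⟨⟨⟨0, by rw [zero_comp, this]⟩⟩⟩
  · have := IsSplitEpi.id (0 : Z ⟶ N)
    rw [comp_zero] at this
    exact hf.2.1 ⟨⟨⟨0, by rw [comp_zero, this]⟩⟩⟩

end KRep

namespace KRep

variable {k : Type u} [Field k] {r : ℕ}

/-! ### The Tits form on the components of S(2) and S(1) -/

theorem arr_eq_row_single (M : KRep k r) (i : Fin r) (x : M.V1) :
    M.arr i x = M.row (Pi.single i x) := by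
  simp [row_apply, Pi.single_apply, apply_ite]

/-- The reflection of an isomorphism. -/
noncomputable def reflIso {M N : KRep k r} (φ : M ≅ N) : M.refl ≅ N.refl where
  hom := reflMap φ.hom
  inv := reflMap φ.inv
  hom_inv_id := by rw [← reflMap_comp, φ.hom_inv_id, reflMap_id]
  inv_hom_id := by rw [← reflMap_comp, φ.inv_hom_id, reflMap_id]

theorem row_surjective_of_iso {M N : KRep k r} (φ : M ≅ N) (h : Function.Surjective M.row) :
    Function.Surjective N.row := fun y => by
  obtain ⟨x, hx⟩ := h (φ.inv.f2 y)
  refine ⟨fun i => φ.hom.f1 (x i), ?_⟩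
  rw [← hom_row, hx]
  exact (isoV2 φ).apply_symm_apply y

theorem col_surjective_of_iso {M N : KRep k r} (φ : M ≅ N) (h : Function.Surjective M.col) :
    Function.Surjective N.col := fun y => by
  obtain ⟨x, hx⟩ := h fun i => φ.inv.f2 (y i)
  refine ⟨φ.hom.f1 x, funext fun i => ?_⟩
  rw [col_apply, ← hom_arr, ← col_apply, hx]
  exact (isoV2 φ).apply_symm_apply (y i)

/-- The Tits form of the Kronecker quiver at the dimension vector of `M`. -/
noncomputable def titsForm (M : KRep k r) : ℤ :=
  (M.dimVector.1 : ℤ) ^ 2 + (M.dimVector.2 : ℤ) ^ 2 - r * M.dimVector.1 * M.dimVector.2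

theorem titsForm_eq_of_iso {M N : KRep k r} (φ : M ≅ N) : M.titsForm = N.titsForm := by
  rw [titsForm, titsForm, dimVector_eq_of_iso φ]

/-- By rank-nullity, reflection acts on dimension vectors as (a, b) ↦ (ra - b, a), an isometry of
the form. -/
theorem titsForm_refl {M : KRep k r} (hM : Function.Surjective M.row) :
    M.refl.titsForm = M.titsForm := by
  have h1 := M.row.finrank_range_add_finrank_ker
  rw [LinearMap.range_eq_top.2 hM, finrank_top, Module.finrank_pi_fintype, Finset.sum_const,
    Finset.card_univ, Fintype.card_fin, smul_eq_mul] at h1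
  have h2 : M.refl.dimVector = (Module.finrank k (LinearMap.ker M.row), Module.finrank k M.V1) :=
    rfl
  have h3 : (Module.finrank k (LinearMap.ker M.row) : ℤ) =
      r * Module.finrank k M.V1 - Module.finrank k M.V2 := by
    rw [eq_sub_iff_add_eq, add_comm]
    exact_mod_cast h1
  rw [titsForm, titsForm, h2]
  simp only [dimVector, h3]
  ring

theorem titsForm_simple1 : (simple1 k r).titsForm = 1 := by
  have h : (simple1 k r).dimVector = (1, 0) :=
    Prod.ext (Module.finrank_self k) (Module.finrank_zero_of_subsingleton (M := PUnit.{u + 1}))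
  simp [titsForm, h]

theorem titsForm_simple2 : (simple2 k r).titsForm = 1 := by
  have h : (simple2 k r).dimVector = (0, 1) :=
    Prod.ext (Module.finrank_zero_of_subsingleton (M := PUnit.{u + 1})) (Module.finrank_self k)
  simp [titsForm, h]

/-- `M` is sent to `S(2)` by `n` reflections. -/
def IsPreproj : ℕ → KRep k r → Prop
  | 0, M => Nonempty (M ≅ simple2 k r)
  | n + 1, M => Function.Surjective M.row ∧ IsPreproj n M.refl

/-- `M` is obtained from `S(1)` by `n` reflections. -/
def IsPreinj : ℕ → KRep k r → Prop
  | 0, M => Nonempty (M ≅ simple1 k r)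
  | n + 1, M => ∃ M' : KRep k r, Function.Surjective M'.row ∧ Nonempty (M'.refl ≅ M) ∧
      IsPreinj n M'

theorem IsPreproj.titsForm {n : ℕ} {M : KRep k r} (h : IsPreproj n M) : M.titsForm = 1 := by
  induction n generalizing M with
  | zero => exact (titsForm_eq_of_iso h.some).trans titsForm_simple2
  | succ n ih => rw [← titsForm_refl h.1, ih h.2]

theorem IsPreinj.titsForm {n : ℕ} {M : KRep k r} (h : IsPreinj n M) : M.titsForm = 1 := by
  induction n generalizing M with
  | zero => exact (titsForm_eq_of_iso h.some).trans titsForm_simple1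
  | succ n ih =>
    obtain ⟨M', h1, ⟨φ⟩, h2⟩ := h
    rw [← titsForm_eq_of_iso φ, titsForm_refl h1, ih h2]

theorem IsPreproj.of_iso {n : ℕ} {M N : KRep k r} (φ : M ≅ N) (h : IsPreproj n M) :
    IsPreproj n N := by
  induction n generalizing M N with
  | zero => exact ⟨φ.symm ≪≫ h.some⟩
  | succ n ih => exact ⟨row_surjective_of_iso φ h.1, ih (reflIso φ) h.2⟩

theorem IsPreinj.of_iso {n : ℕ} {M N : KRep k r} (φ : M ≅ N) (h : IsPreinj n M) :
    IsPreinj n N := by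
  cases n with
  | zero => exact ⟨φ.symm ≪≫ h.some⟩
  | succ n =>
    obtain ⟨M', h1, ⟨χ⟩, h2⟩ := h
    exact ⟨M', h1, ⟨χ ≪≫ φ⟩, h2⟩

theorem not_irreducible_to_simple2 {M : KRep k r} (f : M ⟶ simple2 k r) :
    ¬ IsIrreducibleHom f := fun hf => by
  have h1 : f.f1 = 0 := LinearMap.ext fun x => rfl
  have h2 : ∃ x, f.f2 x ≠ 0 := by
    by_contra! h
    exact hf.ne_zero (hom_ext h1 (LinearMap.ext h))
  obtain ⟨x, hx⟩ := h2
  let s : simple2 k r ⟶ M := homMk 0 (LinearMap.toSpanSingleton k M.V2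
    ((show k from f.f2 x)⁻¹ • x)) fun i y => by
      rw [LinearMap.zero_apply, map_zero]
      exact zero_smul k _
  refine hf.2.1 ⟨⟨⟨s, hom_ext (LinearMap.ext fun y => rfl) (LinearMap.ext fun y => ?_)⟩⟩⟩
  change f.f2 ((show k from y) • (show k from f.f2 x)⁻¹ • x) = y
  rw [map_smul, map_smul]
  change (show k from y) * ((show k from f.f2 x)⁻¹ * (show k from f.f2 x)) = y
  rw [inv_mul_cancel₀ hx, mul_one]

theorem eq_zero_of_simple1 {N : KRep k r} (hN : Function.Injective N.col)
    (f : simple1 k r ⟶ N) : f = 0 := by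
  refine hom_ext (LinearMap.ext fun x => ?_) (LinearMap.ext fun x => ?_)
  · refine (injective_iff_map_eq_zero _).1 hN _ (funext fun i => ?_)
    rw [col_apply, ← hom_arr]
    exact map_zero _
  · exact map_zero f.f2

/-- The map lifts to the free representation `L` on `N.V1`. There the sink is spanned by images of
arrows, so S(2) does not split off; irreducibility makes `L → N` a split epimorphism, and `N` is
free. -/
theorem row_injective_of_irreducible {N : KRep k r} (hN : Function.Surjective N.row)
    {f : simple2 k r ⟶ N} (hf : IsIrreducibleHom f) : Function.Injective N.row := by
  let L : KRep k r := ofArr N.V1 (Fin r → N.V1) fun i => LinearMap.single k (fun _ => N.V1) i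
  have hL (i) (x : N.V1) : L.arr i x = (Pi.single i x : Fin r → N.V1) := by
    rw [ofArr_arr]; rfl
  obtain ⟨x, hx⟩ := hN (f.f2 (1 : k))
  let g : simple2 k r ⟶ L := homMk 0 (LinearMap.toSpanSingleton k (Fin r → N.V1) x) fun i y => by
    rw [LinearMap.zero_apply, map_zero]
    exact zero_smul k x
  let h : L ⟶ N := homMk LinearMap.id N.row fun i y =>
    (congrArg N.row (hL i y)).trans (arr_eq_row_single N i y).symm
  have hgh : g ≫ h = f := by
    refine hom_ext (LinearMap.ext fun y => (map_zero f.f1).symm) (LinearMap.ext fun y => ?_)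
    change N.row ((show k from y) • x) = f.f2 y
    refine (map_smul N.row (show k from y) x).trans ?_
    rw [hx]
    exact (map_smul f.f2 (show k from y) (1 : k)).symm.trans
      (congrArg f.f2 (mul_one (show k from y)))
  rcases hf.2.2 L g h hgh with h0 | h0
  · exfalso
    have h1 := LinearMap.congr_fun (congrArg Hom.f2 (IsSplitMono.id g)) (1 : k)
    have h2 (y : Fin r → N.V1) : (retraction g).f2 y = 0 := by
      rw [← Finset.univ_sum_single y]
      refine (map_sum (retraction g).f2 _ _).trans (Finset.sum_eq_zero fun i _ => ?_)
      exact (congrArg (retraction g).f2 (hL i (y i))).symm.trans (hom_arr (retraction g) i (y i))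
    exact one_ne_zero (α := k) (h1.symm.trans (h2 _))
  · have h1 : ∀ y : N.V1, (section_ h).f1 y = y :=
      LinearMap.congr_fun (congrArg Hom.f1 (IsSplitEpi.id h))
    have h2 (y : Fin r → N.V1) : (section_ h).f2 (N.row y) = y := by
      rw [hom_row, row_apply]
      have h3 (i) : L.arr i ((section_ h).f1 (y i)) = (Pi.single i (y i) : Fin r → N.V1) :=
        (hL i _).trans (congrArg (Pi.single i) (h1 _))
      exact (Finset.sum_congr rfl fun i _ => h3 i).trans (Finset.univ_sum_single y)
    exact Function.LeftInverse.injective h2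

/-- Dual argument with the embedding of `M` into the cofree representation on `M.V2`, which admits
no nonzero map from S(1). -/
theorem col_surjective_of_irreducible {M : KRep k r} (hM : Function.Injective M.col)
    {f : M ⟶ simple1 k r} (hf : IsIrreducibleHom f) : Function.Surjective M.col := by
  let L : KRep k r := ofArr (Fin r → M.V2) M.V2 fun i => LinearMap.proj i
  have hL (i) (x : Fin r → M.V2) : L.arr i x = x i := by
    rw [ofArr_arr]; rfl
  obtain ⟨π, hπ⟩ := M.col.exists_leftInverse_of_injective (LinearMap.ker_eq_bot.2 hM)
  let g : M ⟶ L := homMk M.col LinearMap.id fun i y => (hL i (M.col y)).symm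
  let h : L ⟶ simple1 k r := homMk (f.f1 ∘ₗ π) 0 fun i y => rfl
  have hgh : g ≫ h = f := by
    refine hom_ext (LinearMap.ext fun y => ?_) (LinearMap.ext fun y => rfl)
    exact congrArg f.f1 (LinearMap.congr_fun hπ y)
  rcases hf.2.2 L g h hgh with h0 | h0
  · have h2 : ∀ y : M.V2, (retraction g).f2 y = y :=
      LinearMap.congr_fun (congrArg Hom.f2 (IsSplitMono.id g))
    intro y
    refine ⟨(retraction g).f1 y, funext fun i => ?_⟩
    exact (hom_arr (retraction g) i y).symm.trans
      ((congrArg (retraction g).f2 (hL i y)).trans (h2 _))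
  · exfalso
    have hLc : Function.Injective L.col := fun x y hxy => funext fun i =>
      (hL i x).symm.trans ((congrFun hxy i).trans (hL i y))
    have h1 := IsSplitEpi.id h
    rw [eq_zero_of_simple1 hLc (section_ h), zero_comp] at h1
    exact one_ne_zero (α := k) (LinearMap.congr_fun (congrArg Hom.f1 h1) (1 : k)).symm

theorem refl_iso_simple2 {N : KRep k r} (hi : HasTrivialIdempotents N)
    (hN : Function.Surjective N.row) (hN' : Function.Injective N.row) :
    Nonempty (N.refl ≅ simple2 k r) := by
  rcases row_surjective_or (hi.refl hN) with h | h
  · exfalso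
    have hs : Subsingleton (LinearMap.ker N.row) := by
      rw [LinearMap.ker_eq_bot.2 hN']; infer_instance
    have hs' : Subsingleton (Fin r → N.refl.V1) :=
      @Pi.instSubsingleton _ _ fun _ => hs
    exact (hi.refl hN).1 ((isZero_iff _).2 ⟨hs, h.subsingleton⟩)
  · exact h

theorem iso_simple1_of_refl {M : KRep k r} (hi : HasTrivialIdempotents M)
    (hM : Function.Surjective M.row) (h : Function.Surjective M.refl.col) :
    Nonempty (M ≅ simple1 k r) := by
  have h0 (y : Fin r → M.V1) : M.row y = 0 := by
    obtain ⟨x, hx⟩ := h y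
    have : (show LinearMap.ker M.row from x).1 = y :=
      funext fun i => (refl_arr M i x).symm.trans (congrFun hx i)
    rw [← this]
    exact (show LinearMap.ker M.row from x).2
  have h2 : Subsingleton M.V2 := ⟨fun a b => by
    obtain ⟨a, rfl⟩ := hM a
    obtain ⟨b, rfl⟩ := hM b
    rw [h0, h0]⟩
  rcases col_injective_or hi with h' | h'
  · exact absurd ((isZero_iff _).2 ⟨h'.subsingleton, h2⟩) hi.1
  · exact h'

/-- Reflect the irreducible map until its target is S(2), where none can end. The only source that
cannot be reflected is S(2), which is preprojective already. -/
theorem IsPreproj.source {n : ℕ} {M N : KRep k r} (hM : HasTrivialIdempotents M)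
    {f : M ⟶ N} (hf : IsIrreducibleHom f) (h : IsPreproj n N) : ∃ j, IsPreproj j M := by
  induction n generalizing M N with
  | zero =>
    obtain ⟨φ⟩ := h
    exact absurd (hf.comp_iso (Iso.refl M) φ) (not_irreducible_to_simple2 _)
  | succ n ih =>
    rcases row_surjective_or hM with hr | hr
    · obtain ⟨j, hj⟩ := ih (hM.refl hr) (hf.refl hr h.1) h.2
      exact ⟨j + 1, hr, hj⟩
    · exact ⟨0, hr⟩

/-- After reflecting the source down to S(2), the target is S(2) or free; in the free case one more
reflection gives S(2). -/
theorem IsPreproj.target {n : ℕ} {M N : KRep k r} (hN : HasTrivialIdempotents N)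
    {f : M ⟶ N} (hf : IsIrreducibleHom f) (h : IsPreproj n M) : ∃ j, IsPreproj j N := by
  induction n generalizing M N with
  | zero =>
    obtain ⟨φ⟩ := h
    rcases row_surjective_or hN with hr | hr
    · exact ⟨1, hr, refl_iso_simple2 hN hr
        (row_injective_of_irreducible hr (hf.comp_iso φ.symm (Iso.refl N)))⟩
    · exact ⟨0, hr⟩
  | succ n ih =>
    rcases row_surjective_or hN with hr | hr
    · obtain ⟨j, hj⟩ := ih (hN.refl hr) (hf.refl h.1 hr) h.2
      exact ⟨j + 1, hr, hj⟩
    · exact ⟨0, hr⟩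

theorem exists_irreducible_of_refl_iso {M N M' N' : KRep k r} (hM : Function.Surjective M.row)
    (hN : Function.Surjective N.row) (φ : M.refl ≅ M') (χ : N.refl ≅ N') {f : M' ⟶ N'}
    (hf : IsIrreducibleHom f) : ∃ a : M ⟶ N, IsIrreducibleHom a := by
  obtain ⟨a, ha⟩ := reflMap_surjective hM (φ.hom ≫ f ≫ χ.symm.hom)
  have := hf.comp_iso φ χ.symm
  rw [← ha] at this
  exact ⟨a, this.of_refl hM hN⟩

theorem IsPreinj.source {n : ℕ} {M N : KRep k r} (hM : HasTrivialIdempotents M)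
    {f : M ⟶ N} (hf : IsIrreducibleHom f) (h : IsPreinj n N) : ∃ j, IsPreinj j M := by
  induction n generalizing M N with
  | zero =>
    obtain ⟨φ⟩ := h
    rcases col_injective_or hM with hc | hc
    · obtain ⟨M', hM', ⟨χ⟩⟩ := exists_refl_iso M hc
      have hs := col_surjective_of_irreducible hc (hf.comp_iso (Iso.refl M) φ)
      exact ⟨1, M', hM', ⟨χ⟩, iso_simple1_of_refl ((hM.of_iso χ.symm).of_refl hM') hM'
        (col_surjective_of_iso χ.symm hs)⟩
    · exact ⟨0, hc⟩
  | succ n ih =>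
    obtain ⟨N', hN', ⟨χ⟩, h⟩ := h
    rcases col_injective_or hM with hc | hc
    · obtain ⟨M', hM', ⟨φ⟩⟩ := exists_refl_iso M hc
      obtain ⟨a, ha⟩ := exists_irreducible_of_refl_iso hM' hN' φ χ hf
      obtain ⟨j, hj⟩ := ih ((hM.of_iso φ.symm).of_refl hM') ha h
      exact ⟨j + 1, M', hM', ⟨φ⟩, hj⟩
    · exact ⟨0, hc⟩

theorem IsPreinj.target {n : ℕ} {M N : KRep k r} (hN : HasTrivialIdempotents N)
    {f : M ⟶ N} (hf : IsIrreducibleHom f) (h : IsPreinj n M) : ∃ j, IsPreinj j N := by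
  induction n generalizing M N with
  | zero =>
    obtain ⟨φ⟩ := h
    rcases col_injective_or hN with hc | hc
    · have := hf.comp_iso φ.symm (Iso.refl N)
      exact absurd (eq_zero_of_simple1 hc _) this.ne_zero
    · exact ⟨0, hc⟩
  | succ n ih =>
    obtain ⟨M', hM', ⟨φ⟩, h⟩ := h
    rcases col_injective_or hN with hc | hc
    · obtain ⟨N', hN', ⟨χ⟩⟩ := exists_refl_iso N hc
      obtain ⟨a, ha⟩ := exists_irreducible_of_refl_iso hM' hN' φ χ hf
      obtain ⟨j, hj⟩ := ih ((hN.of_iso χ.symm).of_refl hN') ha h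
      exact ⟨j + 1, N', hN', ⟨χ⟩, hj⟩
    · exact ⟨0, hc⟩

theorem exists_isPreproj {M : KRep k r} (h : SameARComponent (simple2 k r) M) :
    ∃ n, IsPreproj n M := by
  induction h with
  | refl => exact ⟨0, ⟨Iso.refl _⟩⟩
  | tail _ h ih =>
    obtain ⟨n, hn⟩ := ih
    rcases h with ⟨_, hi, f, hf⟩ | ⟨hi, _, f, hf⟩ | ⟨⟨φ⟩⟩
    · exact hn.target (hasTrivialIdempotents_of_indecomposable hi) hf
    · exact hn.source (hasTrivialIdempotents_of_indecomposable hi) hf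
    · exact ⟨n, hn.of_iso φ⟩

theorem exists_isPreinj {M : KRep k r} (h : SameARComponent (simple1 k r) M) :
    ∃ n, IsPreinj n M := by
  induction h with
  | refl => exact ⟨0, ⟨Iso.refl _⟩⟩
  | tail _ h ih =>
    obtain ⟨n, hn⟩ := ih
    rcases h with ⟨_, hi, f, hf⟩ | ⟨hi, _, f, hf⟩ | ⟨⟨φ⟩⟩
    · exact hn.target (hasTrivialIdempotents_of_indecomposable hi) hf
    · exact hn.source (hasTrivialIdempotents_of_indecomposable hi) hf
    · exact ⟨n, hn.of_iso φ⟩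

/-! ### Regularity of bricks -/

theorem IsBrick.eq_zero_or_id_of_idempotent {M : KRep k r} (h : M.IsBrick) (e : M ⟶ M)
    (he : e ≫ e = e) : e = 0 ∨ e = 𝟙 M := by
  obtain ⟨c, h1, h2⟩ := h.2 e
  rcases eq_or_ne c 0 with rfl | hc
  · left
    exact hom_ext (by rw [h1, zero_smul]; rfl) (by rw [h2, zero_smul]; rfl)
  · right
    have := isIso_of_bijective e
      (h1 ▸ ⟨fun x y hxy => smul_right_injective _ hc hxy, fun x => ⟨c⁻¹ • x, by simp [hc]⟩⟩)
      (h2 ▸ ⟨fun x y hxy => smul_right_injective _ hc hxy, fun x => ⟨c⁻¹ • x, by simp [hc]⟩⟩)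
    rw [← cancel_epi e, he, Category.comp_id]

/-- An indecomposable summand of a brick is the whole brick, so its Tits form is that of `M`, which
excludes both components. -/
theorem IsBrick.isRegular {M : KRep k r} (h : M.IsBrick) (hq : M.titsForm ≠ 1) :
    M.IsRegular := by
  rintro N N' ⟨φ⟩ hN
  have hMN : Nonempty (M ≅ N) := by
    rcases h.eq_zero_or_id_of_idempotent (φ.hom ≫ biprod.fst ≫ biprod.inl ≫ φ.inv) (by simp)
      with h0 | h0
    · exfalso
      apply hN.1
      rw [IsZero.iff_id_eq_zero]
      have : biprod.inl ≫ φ.inv ≫ (φ.hom ≫ biprod.fst ≫ biprod.inl ≫ φ.inv) ≫ φ.hom ≫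
          biprod.fst = 𝟙 N := by simp
      rw [← this, h0]; simp
    · exact ⟨φ.hom ≫ biprod.fst, biprod.inl ≫ φ.inv, by simpa using h0, by simp⟩
  obtain ⟨χ⟩ := hMN
  rw [titsForm_eq_of_iso χ] at hq
  refine ⟨fun hp => ?_, fun hp => ?_⟩
  · obtain ⟨n, hn⟩ := exists_isPreproj hp.2
    exact hq hn.titsForm
  · obtain ⟨n, hn⟩ := exists_isPreinj hp.2
    exact hq hn.titsForm

end KRep

namespace KRep

variable {k : Type u} [Field k] {r : ℕ}

/-! ### Restrictions and column spaces -/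

theorem restrict_row {e : ℕ} (a : ArrowSpace k e →ₗ[k] ArrowSpace k r) (M : KRep k r)
    (x : Fin e → M.V1) :
    (restrict a M).row x = M.row (fun l => ∑ i, a (Pi.single i 1) l • x i) := by
  rw [row_apply M]
  refine (row_apply (restrict a M) x).trans ?_
  have h (i) : (restrict a M).arr i (x i) = ∑ l, a (Pi.single i 1) l • M.arr l (x i) :=
    (LinearMap.congr_arg (f := M.ψ) (LinearMap.rTensor_tmul _ a _ _)).trans (ψ_tmul M _ _)
  refine (Finset.sum_congr rfl fun i _ => h i).trans ?_
  simp only [map_sum, map_smul]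
  exact Finset.sum_comm

theorem not_projective_restrict_iff {e : ℕ} (a : ArrowSpace k e →ₗ[k] ArrowSpace k r)
    (M : KRep k r) : ¬ Projective (restrict a M) ↔
      ∃ x : Fin e → M.V1, x ≠ 0 ∧ M.row (fun l => ∑ i, a (Pi.single i 1) l • x i) = 0 := by
  rw [projective_iff, ← row_injective_iff, injective_iff_map_eq_zero]
  push Not
  exact exists_congr fun x => and_comm.trans
    (and_congr Iff.rfl (Eq.congr_left (restrict_row a M x)))

end KRep

theorem Matrix.eq_zero_of_mul_eq_zero_of_mulVec {k : Type*} [Field k] {m n o : Type*} [Fintype n]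
    {A : Matrix m n k} (hA : ∀ x, A.mulVec x = 0 → x = 0) {G : Matrix n o k} (h : A * G = 0) :
    G = 0 := by
  ext p q
  exact congrFun (hA (fun p => G p q) (funext fun l => congrFun (congrFun h l) q)) p

theorem Matrix.range_mulVecLin_le_iff {k : Type*} [Field k] {m n o : Type*} [Fintype n] [Fintype o]
    [DecidableEq o] {A : Matrix m n k} {B : Matrix m o k} :
    LinearMap.range B.mulVecLin ≤ LinearMap.range A.mulVecLin ↔ ∃ G : Matrix n o k, B = A * G := by
  constructor
  · intro h
    have h' (q : o) : ∃ x, A.mulVec x = B.mulVec (Pi.single q 1) := h ⟨Pi.single q 1, rfl⟩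
    choose g hg using h'
    refine ⟨Matrix.of fun p q => g q p, Matrix.ext fun l q => ?_⟩
    have := congrFun (hg q) l
    rw [Matrix.mulVec_single_one] at this
    exact this.symm
  · rintro ⟨G, rfl⟩
    rw [Matrix.mulVecLin_mul]
    exact LinearMap.range_comp_le_range _ _

/-! ### Extension data and their endomorphisms -/

/-- Matrices `α none` and `α (some s)` of maximal rank with pairwise distinct column spaces, and
families `η s` of matrices that are independent modulo `α (some s)` and the matrices with columns
in the column space of `α none`. -/
structure ExtensionDatum (k : Type u) [Field k] (r d : ℕ) (S : Type u) (N : ℕ) where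
  α : Option S → Matrix (Fin r) (Fin d) k
  η : S → Fin N → Matrix (Fin r) (Fin d) k
  inj : ∀ t x, (α t).mulVec x = 0 → x = 0
  sep : ∀ s t, LinearMap.range (α s).mulVecLin = LinearMap.range (α t).mulVecLin → s = t
  indep : ∀ s (c : Fin N → k) (b : k) (B : Matrix (Fin d) (Fin d) k),
    ∑ i, c i • η s i = b • α (some s) + α none * B → c = 0

namespace ExtensionDatum

open Matrix

variable {k : Type u} [Field k] {r d : ℕ} {S : Type u} {N : ℕ} (D : ExtensionDatum k r d S N)

theorem finrank_range (t : Option S) :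
    Module.finrank k (LinearMap.range (D.α t).mulVecLin) = d := by
  rw [LinearMap.finrank_range_of_inj, Module.finrank_fin_fun]
  exact (injective_iff_map_eq_zero _).2 (D.inj t)

theorem eq_of_mul_eq {s t : Option S} {G : Matrix (Fin d) (Fin d) k} {c : k} (hc : c ≠ 0)
    (h : D.α s * G = c • D.α t) : s = t := by
  refine (D.sep t s (Submodule.eq_of_le_of_finrank_eq ?_ ?_)).symm
  · refine range_mulVecLin_le_iff.2 ⟨c⁻¹ • G, ?_⟩
    rw [Matrix.mul_smul, h, smul_smul, inv_mul_cancel₀ hc, one_smul]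
  · rw [finrank_range, finrank_range]

theorem eq_zero_of_smul_eq_zero (hd : 0 < d) {t : Option S} {c : k} (h : c • D.α t = 0) :
    c = 0 := by
  by_contra hc
  have h0 : D.α t = 0 := (smul_eq_zero.1 h).resolve_left hc
  have := congrFun (D.inj t 1 (by rw [h0, zero_mulVec])) ⟨0, hd⟩
  exact one_ne_zero this

/-- The components of the extension cocycle. -/
def cocycle : Option (S × Fin N) → Matrix (Fin r) (Fin d) k
  | none => 0
  | some q => D.η q.1 q.2

/-- The relation with coefficients `c`, in component `j`. -/
def relMatrix (c : Option (S × Fin N) → k) (j : Option (S × Fin N)) : Matrix (Fin r) (Fin d) k :=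
  c j • D.α (j.map Prod.fst) + c none • D.cocycle j

@[simp]
theorem relMatrix_none (c : Option (S × Fin N) → k) :
    D.relMatrix c none = c none • D.α none := by
  simp [relMatrix, cocycle]

@[simp]
theorem relMatrix_some (c : Option (S × Fin N) → k) (q : S × Fin N) :
    D.relMatrix c (some q) = c (some q) • D.α (some q.1) + c none • D.η q.1 q.2 := rfl

/-- The map whose range is the space of relations. -/
def relMap : (Option (S × Fin N) → k) →ₗ[k] (Fin r → Option (S × Fin N) → Fin d → k) where
  toFun c l j p := D.relMatrix c j l p
  map_add' c c' := by
    ext l j p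
    simp only [relMatrix, Pi.add_apply, Matrix.add_apply, Matrix.smul_apply, smul_eq_mul]
    ring
  map_smul' b c := by
    ext l j p
    simp only [relMatrix, Pi.smul_apply, Matrix.add_apply, Matrix.smul_apply, smul_eq_mul,
      RingHom.id_apply]
    ring

theorem relMap_apply (c : Option (S × Fin N) → k) (l : Fin r) (j : Option (S × Fin N))
    (p : Fin d) : D.relMap c l j p = D.relMatrix c j l p := rfl

theorem eq_zero_of_relMatrix_eq_zero (hd : 0 < d) {c : Option (S × Fin N) → k}
    (h : ∀ j, D.relMatrix c j = 0) : c = 0 := by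
  have h0 : c none = 0 := D.eq_zero_of_smul_eq_zero hd ((D.relMatrix_none c).symm.trans (h none))
  funext j
  cases j with
  | none => exact h0
  | some q =>
    have := h (some q)
    rw [relMatrix_some, h0, zero_smul, add_zero] at this
    exact D.eq_zero_of_smul_eq_zero hd this

/-- The blocks `G i j` describe an endomorphism on V1. Relations supported on one copy `some q` use
only the distinctness of column spaces: they make the blocks scalar, and zero between different
labels. The relation through `none` then ties all scalars together by independence of the cocycle.
-/
theorem exists_scalar_of_preserves [Fintype S]
    (G : Option (S × Fin N) → Option (S × Fin N) → Matrix (Fin d) (Fin d) k)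
    (h : ∀ c, ∃ c', ∀ i, ∑ j, D.relMatrix c j * G i j = D.relMatrix c' i) :
    ∃ γ : k, ∀ i, G i i = γ • 1 ∧ ∀ j, j ≠ i → G i j = 0 := by
  classical
  have cancel {t : Option S} {X Y : Matrix (Fin d) (Fin d) k} (h : D.α t * X = D.α t * Y) :
      X = Y := by
    rw [← sub_eq_zero, ← Matrix.mul_sub] at h
    exact sub_eq_zero.1 (Matrix.eq_zero_of_mul_eq_zero_of_mulVec (D.inj t) h)
  have scal {s t : Option S} {X : Matrix (Fin d) (Fin d) k} {c : k}
      (h : D.α s * X = c • D.α t) : X = c • 1 ∧ (c ≠ 0 → s = t) := by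
    have hst := fun hc => D.eq_of_mul_eq (c := c) hc h
    refine ⟨cancel (t := s) ?_, hst⟩
    by_cases hc : c = 0
    · rw [h, hc]; simp
    · rw [h, hst hc]; simp
  have hsome (q : S × Fin N) : G none (some q) = 0 ∧ ∀ p, ∃ c : k,
      G (some p) (some q) = c • 1 ∧ (c ≠ 0 → q.1 = p.1) := by
    obtain ⟨c', hc'⟩ := h (Pi.single (some q) 1)
    have hsum (i) : ∑ j, D.relMatrix (Pi.single (some q) 1) j * G i j =
        D.α (some q.1) * G i (some q) := by
      rw [Finset.sum_eq_single (some q)]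
      · simp
      · intro j _ hj
        simp [relMatrix, hj]
      · simp
    have h0 := hc' none
    rw [hsum, relMatrix_none] at h0
    obtain ⟨h1, h2⟩ := scal h0
    have h3 : c' none = 0 := by
      by_contra h3
      exact absurd (h2 h3) (by simp)
    rw [h3, zero_smul] at h1
    refine ⟨h1, fun p => ?_⟩
    have h4 := hc' (some p)
    rw [hsum, relMatrix_some, h3, zero_smul, add_zero] at h4
    obtain ⟨h5, h6⟩ := scal h4
    exact ⟨_, h5, fun hc => Option.some_injective _ (h6 hc)⟩
  choose hns C hC hCs using hsome
  obtain ⟨c', hc'⟩ := h (Pi.single none 1)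
  have hsum (i) : ∑ j, D.relMatrix (Pi.single none 1) j * G i j =
      D.α none * G i none + ∑ q : S × Fin N, D.η q.1 q.2 * G i (some q) := by
    rw [Fintype.sum_option]
    simp
  have h0 := hc' none
  rw [hsum, relMatrix_none] at h0
  simp only [hns, Matrix.mul_zero, Finset.sum_const_zero, add_zero] at h0
  have hp (p : S × Fin N) : G (some p) none = 0 ∧
      ∀ i, C (p.1, i) p = Pi.single (M := fun _ => k) p.2 (c' none) i := by
    have h1 := hc' (some p)
    rw [hsum, relMatrix_some] at h1
    have h2 : ∑ q : S × Fin N, D.η q.1 q.2 * G (some p) (some q) =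
        ∑ i, C (p.1, i) p • D.η p.1 i := by
      rw [Fintype.sum_prod_type, Finset.sum_eq_single p.1]
      · simp [hC]
      · intro s _ hs
        refine Finset.sum_eq_zero fun i _ => ?_
        have : C (s, i) p = 0 := by
          by_contra h3
          exact hs (hCs (s, i) p h3)
        rw [hC, this]; simp
      · simp
    rw [h2] at h1
    -- Modulo `α (some p.1)` and `α none * B`, the equation compares two combinations of the `η p.1
    -- i`; independence equates their coefficients.
    have h3 := D.indep p.1 ((fun i => C (p.1, i) p) - Pi.single p.2 (c' none)) (c' (some p))
      (-G (some p) none) (by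
        simp only [Pi.sub_apply, sub_smul, Finset.sum_sub_distrib, Pi.single_apply, ite_smul,
          zero_smul, Finset.sum_ite_eq', Finset.mem_univ, if_true, Matrix.mul_neg]
        rw [sub_eq_iff_eq_add, ← sub_eq_add_neg, sub_add_eq_add_sub, ← h1, add_sub_cancel_left])
    have h4 := sub_eq_zero.1 h3
    refine ⟨?_, fun i => congrFun h4 i⟩
    have h5 : ∑ i, C (p.1, i) p • D.η p.1 i = c' none • D.η p.1 p.2 := by
      rw [Finset.sum_congr rfl fun i _ => by rw [congrFun h4 i]]
      simp [Pi.single_apply, ite_smul]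
    -- Once the cocycle terms cancel, `α none * G (some p) none` is a multiple of `α (some p.1)`,
    -- and distinct column spaces make it zero.
    rw [h5, add_left_inj] at h1
    obtain ⟨h6, h7⟩ := scal h1
    have h8 : c' (some p) = 0 := by
      by_contra h3
      exact absurd (h7 h3) (by simp)
    rw [h6, h8, zero_smul]
  refine ⟨c' none, fun i => ?_⟩
  cases i with
  | none =>
    refine ⟨(scal h0).1, fun j hj => ?_⟩
    cases j with
    | none => exact absurd rfl hj
    | some q => exact hns q
  | some p =>
    refine ⟨?_, fun j hj => ?_⟩
    · rw [hC, (hp p).2 p.2, Pi.single_eq_same]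
    · cases j with
      | none => exact (hp p).1
      | some q =>
        have : C q p = 0 := by
          by_contra h3
          have h4 := hCs q p h3
          obtain ⟨s, i⟩ := q
          obtain rfl : s = p.1 := h4
          refine h3 (((hp p).2 i).trans (Pi.single_eq_of_ne ?_ _))
          rintro rfl
          exact hj rfl
        rw [hC, this, zero_smul]

variable [Finite S]

/-! ### The extension: dimension, rank varieties, brick property -/

/-- The extension of the representation attached to `α none` by copies of those attached
to the `α (some s)`. -/
noncomputable def rep : KRep k r :=
  KRep.ofRelations (Option (S × Fin N) → Fin d → k) (LinearMap.range D.relMap)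

theorem rep_row_eq_zero_iff (y : Fin r → Option (S × Fin N) → Fin d → k) :
    D.rep.row y = 0 ↔ ∃ c, ∀ j, D.relMatrix c j = Matrix.of fun l p => y l j p := by
  have h1 : D.rep.row = (LinearMap.range D.relMap).mkQ := KRep.ofRelations_row _ _
  have h2 : D.rep.row y = (LinearMap.range D.relMap).mkQ y := LinearMap.congr_fun h1 y
  refine (Eq.congr_left h2).trans ((Submodule.Quotient.mk_eq_zero _).trans ?_)
  refine exists_congr fun c => ⟨?_, fun h => ?_⟩
  · rintro rfl j
    rfl
  · ext l j p
    exact congrFun (congrFun (h j) l) p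

theorem rep_row_surjective : Function.Surjective D.rep.row := fun y => by
  have h1 : D.rep.row = (LinearMap.range D.relMap).mkQ := KRep.ofRelations_row _ _
  obtain ⟨x, hx⟩ := Submodule.mkQ_surjective (LinearMap.range D.relMap) y
  exact ⟨x, (LinearMap.congr_fun h1 x).trans hx⟩

theorem dimVector_rep (hd : 0 < d) :
    D.rep.dimVector = (Nat.card S * N + 1) • (d, r * d - 1) := by
  have := Fintype.ofFinite S
  have hJ : Fintype.card (Option (S × Fin N)) = Nat.card S * N + 1 := by
    simp
  have hinj : Function.Injective D.relMap := by
    rw [injective_iff_map_eq_zero]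
    intro c hc
    refine D.eq_zero_of_relMatrix_eq_zero hd fun j => Matrix.ext fun l p => ?_
    exact congrFun (congrFun (congrFun hc l) j) p
  have h1 : Module.finrank k (Option (S × Fin N) → Fin d → k) = (Nat.card S * N + 1) * d := by
    rw [Module.finrank_pi_fintype]
    simp only [Module.finrank_fin_fun, Finset.sum_const, Finset.card_univ, hJ, smul_eq_mul]
  have h2 := Submodule.finrank_quotient_add_finrank (LinearMap.range D.relMap)
  rw [LinearMap.finrank_range_of_inj hinj, Module.finrank_fintype_fun_eq_card, hJ,
    Module.finrank_pi_fintype, Finset.sum_const, h1, Finset.card_univ, Fintype.card_fin,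
    smul_eq_mul] at h2
  refine Prod.ext h1 ?_
  change Module.finrank k ((Fin r → Option (S × Fin N) → Fin d → k) ⧸ LinearMap.range D.relMap) =
    (Nat.card S * N + 1) * (r * d - 1)
  rw [Nat.mul_sub, mul_one]
  apply Nat.eq_sub_of_add_eq
  rw [h2]; ring

/-- Some nonzero relation has all its components of the form `A * X`. A component that is a nonzero
multiple of `α t` puts a d-dimensional column space inside im a, and e ≤ d forces equality. -/
theorem exists_range_eq_of_not_projective [Nonempty S] (hN : 0 < N) {e : ℕ} (he : e ≤ d)
    (a : ArrowSpace k e →ₗ[k] ArrowSpace k r) (ha : Function.Injective a)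
    (h : ¬ Projective (D.rep.restrict a)) :
    ∃ s, LinearMap.range (D.α (some s)).mulVecLin = LinearMap.range a := by
  obtain ⟨x, hx, hr⟩ := (KRep.not_projective_restrict_iff a D.rep).1 h
  obtain ⟨c, hc⟩ := (D.rep_row_eq_zero_iff _).1 hr
  replace hx : ∃ x' : Fin e → Option (S × Fin N) → Fin d → k, x' ≠ 0 ∧
      ∀ j, D.relMatrix c j = LinearMap.toMatrix' a * Matrix.of fun i p => x' i j p := by
    refine ⟨x, hx, fun j => (hc j).trans (Matrix.ext fun l p => ?_)⟩
    have h1 (x : Fin e → Option (S × Fin N) → Fin d → k) :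
        (∑ i, a (Pi.single i 1) l • x i) j p = ∑ i, a (Pi.single i 1) l * x i j p := by
      simp
    refine (h1 x).trans ?_
    simp only [Matrix.mul_apply, LinearMap.toMatrix'_apply]
    rfl
  clear hc hr
  obtain ⟨x, hx, hc⟩ := hx
  set A := LinearMap.toMatrix' a with hA
  have hAa : A.mulVecLin = a := by
    rw [hA, ← Matrix.toLin'_apply', Matrix.toLin'_toMatrix']
  have hAinj (y) (hy : A.mulVec y = 0) : y = 0 := by
    rw [← Matrix.mulVecLin_apply, hAa] at hy
    exact (injective_iff_map_eq_zero a).1 ha y hy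
  have hc0 : c ≠ 0 := by
    rintro rfl
    apply hx
    ext i j p
    have h0 : A * (Matrix.of fun i p => x i j p) = 0 := by
      rw [← hc j]
      simp [relMatrix]
    exact congrFun (congrFun (Matrix.eq_zero_of_mul_eq_zero_of_mulVec hAinj h0) i) p
  have key {t : Option S} {b : k} {X : Matrix (Fin e) (Fin d) k} (hb : b ≠ 0)
      (h : b • D.α t = A * X) : LinearMap.range (D.α t).mulVecLin = LinearMap.range a := by
    have hle : LinearMap.range (D.α t).mulVecLin ≤ LinearMap.range a := by
      rw [← hAa]
      refine Matrix.range_mulVecLin_le_iff.2 ⟨b⁻¹ • X, ?_⟩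
      rw [Matrix.mul_smul, ← h, smul_smul, inv_mul_cancel₀ hb, one_smul]
    refine Submodule.eq_of_le_of_finrank_le hle ?_
    rw [finrank_range, LinearMap.finrank_range_of_inj ha, Module.finrank_fin_fun]
    exact he
  -- Otherwise im a is the column space of `α none`, and the component at `(s, 0)` would express `η
  -- s 0` through `α (some s)` and `α none * B`.
  have hnone : c none = 0 := by
    by_contra hb
    have h1 := key hb ((D.relMatrix_none c).symm.trans (hc none))
    obtain ⟨B, hB⟩ := Matrix.range_mulVecLin_le_iff.1 ((congrArg _ hAa).trans h1.symm).le
    obtain ⟨s⟩ := ‹Nonempty S›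
    have h2 := hc (some (s, ⟨0, hN⟩))
    rw [relMatrix_some, hB, Matrix.mul_assoc] at h2
    have h3 := D.indep s (Pi.single ⟨0, hN⟩ (c none)) (-c (some (s, ⟨0, hN⟩))) _ (by
      rw [← h2]
      simp [Pi.single_apply, ite_smul])
    exact hb (by simpa using congrFun h3 ⟨0, hN⟩)
  obtain ⟨j, hj⟩ := Function.ne_iff.1 hc0
  cases j with
  | none => exact absurd hnone hj
  | some q =>
    have h2 := hc (some q)
    rw [relMatrix_some, hnone, zero_smul, add_zero] at h2
    exact ⟨q.1, key hj h2⟩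

theorem not_projective_of_range_eq (hd : 0 < d) (hN : 0 < N) {e : ℕ}
    (a : ArrowSpace k e →ₗ[k] ArrowSpace k r) (s : S)
    (h : LinearMap.range (D.α (some s)).mulVecLin = LinearMap.range a) :
    ¬ Projective (D.rep.restrict a) := by
  classical
  have hAa : (LinearMap.toMatrix' a).mulVecLin = a := by
    rw [← Matrix.toLin'_apply', Matrix.toLin'_toMatrix']
  obtain ⟨X, hX⟩ := Matrix.range_mulVecLin_le_iff.1 (h.trans (congrArg _ hAa).symm).le
  -- The relation supported on one copy of `s` is the witness; a copy exists because N > 0.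
  let j₀ : Option (S × Fin N) := some (s, ⟨0, hN⟩)
  let x : Fin e → Option (S × Fin N) → Fin d → k := fun i j p => if j = j₀ then X i p else 0
  refine (KRep.not_projective_restrict_iff a D.rep).2 ⟨x, fun hx => ?_, ?_⟩
  · have hX0 : X = 0 := Matrix.ext fun i p => by
      have := congrFun (congrFun (congrFun hx i) j₀) p
      exact (if_pos rfl).symm.trans this
    rw [hX0, Matrix.mul_zero] at hX
    exact one_ne_zero (α := k) (D.eq_zero_of_smul_eq_zero hd (t := some s) (by rw [hX, smul_zero]))
  · refine (D.rep_row_eq_zero_iff _).2 ⟨Pi.single j₀ 1, fun j => Matrix.ext fun l p => ?_⟩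
    have h1 : (∑ i, a (Pi.single i 1) l • x i) j p =
        ∑ i, a (Pi.single i 1) l * x i j p := by
      simp
    refine Eq.trans ?_ h1.symm
    by_cases hj : j = j₀
    · subst hj
      simp [x, j₀, hX, Matrix.mul_apply, LinearMap.toMatrix'_apply]
    · simp [x, hj, relMatrix, j₀]

/-- An endomorphism is determined by its action on V1, which must preserve the space of relations.
-/
theorem rep_isBrick (hd : 0 < d) : D.rep.IsBrick := by
  classical
  have := Fintype.ofFinite S
  constructor
  · intro h
    have h1 : Subsingleton (Option (S × Fin N) → Fin d → k) := ((KRep.isZero_iff _).1 h).1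
    have h2 := congrFun (congrFun (h1.elim 1 0) none) ⟨0, hd⟩
    exact one_ne_zero (α := k) h2
  · intro f
    let F : (Option (S × Fin N) → Fin d → k) →ₗ[k] (Option (S × Fin N) → Fin d → k) := f.f1
    let G (i j : Option (S × Fin N)) : Matrix (Fin d) (Fin d) k :=
      Matrix.of fun p q => F (Pi.single j (Pi.single p 1)) i q
    have hF (y : Option (S × Fin N) → Fin d → k) (i q) :
        F y i q = ∑ j, ∑ p, y j p * G i j p q := by
      have hy : y = ∑ j, ∑ p, y j p • Pi.single j (Pi.single p 1) := by
        ext j p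
        simp [Finset.sum_apply, Pi.single_apply, apply_ite, ite_apply, Finset.sum_ite_eq]
      conv_lhs => rw [hy]
      simp [G, Finset.sum_apply]
    have hG (c) : ∃ c', ∀ i, ∑ j, D.relMatrix c j * G i j = D.relMatrix c' i := by
      have h0 : D.rep.row (D.relMap c) = 0 :=
        (D.rep_row_eq_zero_iff _).2 ⟨c, fun j => rfl⟩
      have h1 : D.rep.row (fun l => f.f1 (D.relMap c l)) = 0 := by
        rw [← KRep.hom_row f (D.relMap c), h0, map_zero]
      obtain ⟨c', hc'⟩ := (D.rep_row_eq_zero_iff _).1 h1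
      refine ⟨c', fun i => (Matrix.ext fun l q => ?_ : _ = Matrix.of _).trans (hc' i).symm⟩
      refine Eq.trans ?_ (hF (D.relMap c l) i q).symm
      simp [Matrix.sum_apply, Matrix.mul_apply, relMap_apply]
    obtain ⟨γ, hγ⟩ := D.exists_scalar_of_preserves G hG
    have hFγ (y) : F y = γ • y := by
      ext i q
      rw [hF, Finset.sum_eq_single i]
      · simp [(hγ i).1, Matrix.one_apply, mul_comm]
      · intro j _ hj
        simp [(hγ i).2 j hj]
      · simp
    refine ⟨γ, LinearMap.ext hFγ, LinearMap.ext fun z => ?_⟩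
    obtain ⟨y, rfl⟩ := D.rep_row_surjective z
    rw [KRep.hom_row]
    have : (fun i => f.f1 (y i)) = γ • y := funext fun i => hFγ (y i)
    rw [this, map_smul]; rfl

end ExtensionDatum

/-! ### Existence of extension data -/

section Grassmannian

variable {k : Type u} [Field k] {r d : ℕ}

theorem KGr.exists_matrix (v : KGr k d r) : ∃ A : Matrix (Fin r) (Fin d) k,
    (∀ x, A.mulVec x = 0 → x = 0) ∧ LinearMap.range A.mulVecLin = v.1 := by
  let e : (Fin d → k) ≃ₗ[k] v.1 := LinearEquiv.ofFinrankEq _ _ (by rw [v.2, Module.finrank_fin_fun])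
  let f : (Fin d → k) →ₗ[k] (Fin r → k) := v.1.subtype ∘ₗ e.toLinearMap
  have hf : (LinearMap.toMatrix' f).mulVecLin = f := by
    rw [← Matrix.toLin'_apply', Matrix.toLin'_toMatrix']
  refine ⟨LinearMap.toMatrix' f, fun x hx => ?_, ?_⟩
  · rw [← Matrix.mulVecLin_apply, hf] at hx
    exact e.injective ((Subtype.ext hx).trans (map_zero e).symm)
  · rw [hf, LinearMap.range_comp, LinearEquiv.range, Submodule.map_top, Submodule.range_subtype]

/-- Graphs over the first d coordinates: the coordinate with index d equals t times the one with
index 0, so the subspace recovers t. -/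
theorem KGr.infinite [Infinite k] (hd : 0 < d) (hdr : d < r) : Infinite (KGr k d r) := by
  let f (t : k) : (Fin d → k) →ₗ[k] (Fin r → k) := LinearMap.pi fun i =>
    if h : i.1 < d then LinearMap.proj ⟨i.1, h⟩ else t • LinearMap.proj ⟨0, hd⟩
  have h1 (t x) (i : Fin d) : f t x ⟨i.1, i.2.trans hdr⟩ = x i := by
    simp [f]
  have h2 (t x) : f t x ⟨d, hdr⟩ = t * x ⟨0, hd⟩ := by
    simp [f]
  have hinj (t) : Function.Injective (f t) := fun x y hxy => funext fun i => by
    rw [← h1 t x i, hxy, h1]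
  let g (t : k) : KGr k d r := ⟨LinearMap.range (f t), by
    rw [LinearMap.finrank_range_of_inj (hinj t), Module.finrank_fin_fun]⟩
  refine Infinite.of_injective g fun s t hst => ?_
  have h3 : f s 1 ∈ LinearMap.range (f t) := by
    rw [← show LinearMap.range (f s) = LinearMap.range (f t) from congrArg Subtype.val hst]
    exact ⟨1, rfl⟩
  obtain ⟨y, hy⟩ := h3
  have h4 : y = 1 := funext fun i => by rw [← h1 t y i, hy, h1]
  have h5 := congrFun hy ⟨d, hdr⟩
  rw [h2, h2, h4] at h5
  simpa using h5.symm

theorem exists_independent_family (A B : Matrix (Fin r) (Fin d) k) {N : ℕ}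
    (hN : N + (d * d + 1) ≤ r * d) : ∃ η : Fin N → Matrix (Fin r) (Fin d) k,
      ∀ (c : Fin N → k) (b : k) (X : Matrix (Fin d) (Fin d) k),
        ∑ i, c i • η i = b • A + B * X → c = 0 := by
  let L : Matrix (Fin d) (Fin d) k →ₗ[k] Matrix (Fin r) (Fin d) k :=
    { toFun := fun X => B * X
      map_add' := fun X Y => Matrix.mul_add B X Y
      map_smul' := fun c X => Matrix.mul_smul B c X }
  let W := Submodule.span k {A} ⊔ LinearMap.range L
  have hW : Module.finrank k W ≤ d * d + 1 := by
    refine (Submodule.finrank_add_le_finrank_add_finrank _ _).trans ?_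
    have h1 : Module.finrank k (Submodule.span k {A}) ≤ 1 := by
      simpa using finrank_span_le_card (R := k) ({A} : Set (Matrix (Fin r) (Fin d) k))
    have h2 : Module.finrank k (LinearMap.range L) ≤ d * d := by
      simpa [Module.finrank_matrix] using LinearMap.finrank_range_le L
    omega
  have hQ := W.finrank_quotient_add_finrank
  rw [Module.finrank_matrix, Fintype.card_fin, Fintype.card_fin, Module.finrank_self, mul_one]
    at hQ
  obtain ⟨b, hb⟩ := exists_linearIndependent_of_le_finrank (R := k)
    (M := Matrix (Fin r) (Fin d) k ⧸ W) (n := N) (by omega)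
  choose η hη using fun i => W.mkQ_surjective (b i)
  refine ⟨η, fun c t X h => funext fun i => Fintype.linearIndependent_iff.1 hb c ?_ i⟩
  have h1 : W.mkQ (∑ i, c i • η i) = 0 := by
    rw [h]
    refine (Submodule.Quotient.mk_eq_zero W).2 (W.add_mem ?_ ?_)
    · exact Submodule.mem_sup_left (Submodule.smul_mem _ _ (Submodule.mem_span_singleton_self A))
    · exact Submodule.mem_sup_right ⟨X, rfl⟩
  simpa [map_sum, hη] using h1

theorem exists_extensionDatum [Infinite k] (hd : 0 < d) (hdr : d < r) (X : Finset (KGr k d r)) :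
    ∃ D : ExtensionDatum k r d X (d * (r - d) - 1),
      ∀ v : X, LinearMap.range (D.α (some v)).mulVecLin = v.1.1 := by
  have := KGr.infinite (k := k) hd hdr
  obtain ⟨v₀, hv₀⟩ := Infinite.exists_notMem_finset X
  choose A hA hAr using KGr.exists_matrix (k := k) (r := r) (d := d)
  -- In fact an equality: N is the codimension left by the d² matrices `α none * B` and the line of
  -- `α (some s)`. Since d(r - d) ≥ 1, the truncated subtraction is exact.
  have hN : d * (r - d) - 1 + (d * d + 1) ≤ r * d := by
    obtain ⟨t, rfl⟩ := Nat.exists_eq_add_of_lt hdr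
    have h1 : d + t + 1 - d = t + 1 := by omega
    have h2 : 1 ≤ d * (t + 1) := Nat.mul_pos hd t.succ_pos
    have h3 : (d + t + 1) * d = d * (t + 1) + d * d := by ring
    rw [h1, h3]
    omega
  choose η hη using fun v : X => exists_independent_family (A v.1) (A v₀) hN
  let p : Option X → KGr k d r := fun t => t.elim v₀ Subtype.val
  refine ⟨⟨fun t => A (p t), η, fun t => hA _, fun s t h => ?_, hη⟩, fun v => hAr v.1⟩
  have h' : p s = p t := Subtype.ext ((hAr _).symm.trans (h.trans (hAr _)))
  rcases s with _ | s <;> rcases t with _ | t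
  · rfl
  · exact absurd t.2 (by rwa [← show v₀ = t.1 from h'])
  · exact absurd s.2 (by rwa [show s.1 = v₀ from h'])
  · exact congrArg some (Subtype.ext h')

end Grassmannian

/-! ### Conclusion -/

theorem KRep.titsForm_ne_one_of_dimVector {k : Type u} [Field k] {r d m : ℕ} (hd : 1 < d)
    (hdr : d < r) {M : KRep k r} (h : M.dimVector = m • (d, r * d - 1)) : M.titsForm ≠ 1 := by
  have hrd : 1 ≤ r * d := Nat.mul_pos (by omega) (by omega)
  rw [KRep.titsForm, h]
  simp only [Prod.smul_mk, smul_eq_mul, Nat.cast_mul, Nat.cast_sub hrd, Nat.cast_one]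
  obtain ⟨t, rfl⟩ := Nat.exists_eq_add_of_lt hdr
  push_cast
  have h1 : ((m : ℤ) * d) ^ 2 + ((m : ℤ) * ((d + t + 1) * d - 1)) ^ 2 -
      (d + t + 1) * (m * d) * (m * ((d + t + 1) * d - 1)) = (m : ℤ) ^ 2 * (1 - d * (t + 1)) := by
    ring
  rw [h1]
  have h2 : (1 : ℤ) - d * (t + 1) ≤ 0 := by
    have : 1 ≤ d * (t + 1) := Nat.mul_pos (by omega) t.succ_pos
    zify at this
    linarith
  have := mul_nonpos_of_nonneg_of_nonpos (sq_nonneg (m : ℤ)) h2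
  linarith

theorem theorem6p5p6 (k : Type u) [Field k] [IsAlgClosed k] (r d : ℕ) (hr : 3 ≤ r)
    (hd : 1 < d) (hdr : d < r) (X : Finset (KGr k d r)) (hX : X.Nonempty) :
    ∃ E : KRep k r, E.IsRegular ∧ E.IsBrick ∧
      E.rankVariety d = (X : Set (KGr k d r)) ∧
      E.IsRelProjective (d - 1) ∧
      E.dimVector = (X.card * (d * (r - d) - 1) + 1) • (d, r * d - 1) := by
  have : Infinite k := IsAlgClosed.instInfinite
  have hd0 : 0 < d := by omega
  -- Here d > 1 matters: every element of X must contribute at least one copy.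
  have hN : 0 < d * (r - d) - 1 := by
    have : d * 1 ≤ d * (r - d) := Nat.mul_le_mul_left d (by omega)
    omega
  obtain ⟨D, hD⟩ := exists_extensionDatum hd0 hdr X
  have : Nonempty X := hX.to_subtype
  have hdim : D.rep.dimVector = (X.card * (d * (r - d) - 1) + 1) • (d, r * d - 1) := by
    rw [D.dimVector_rep hd0, Nat.card_eq_fintype_card, Fintype.card_coe]
  have hbrick := D.rep_isBrick hd0
  refine ⟨D.rep, hbrick.isRegular (KRep.titsForm_ne_one_of_dimVector hd hdr hdim), hbrick,
    Set.ext fun v => ⟨fun hv => ?_, fun hv α _ hαv => ?_⟩, Set.eq_empty_of_forall_notMem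
      fun v hv => ?_, hdim⟩
  · obtain ⟨A, hA, hAv⟩ := v.exists_matrix
    have hinj : Function.Injective A.mulVecLin := (injective_iff_map_eq_zero _).2 hA
    obtain ⟨s, hs⟩ := D.exists_range_eq_of_not_projective hN le_rfl A.mulVecLin hinj
      (hv _ hinj hAv)
    have : s.1 = v := Subtype.ext ((hD s).symm.trans (hs.trans hAv))
    rw [← this]
    exact s.2
  · exact D.not_projective_of_range_eq hd0 hN α ⟨v, hv⟩ ((hD ⟨v, hv⟩).trans hαv.symm)
  · obtain ⟨A, hA, hAv⟩ := v.exists_matrix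
    have hinj : Function.Injective A.mulVecLin := (injective_iff_map_eq_zero _).2 hA
    obtain ⟨s, hs⟩ := D.exists_range_eq_of_not_projective hN (Nat.sub_le d 1) A.mulVecLin hinj
      (hv _ hinj hAv)
    -- The same subspace would have dimension d and d - 1.
    have h1 := D.finrank_range (some s)
    rw [hs, hAv, v.2] at h1
    omega
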